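/- Let $k$ be a field of characteristic zero, $\hbar$ a formal variable and $q=1+\hbar\in k[[\hbar]]$. Let $W_1=k\{x,y\}/(xy-yx-1)$ be the Weyl algebra over $k$ and let $W_1[[\hbar]]$ be the $k[[\hbar]]$-algebra of formal power series in the central variable $\hbar$ with coefficients in $W_1$. Let $W_q=k[[\hbar]]\{x,y\}/(qxy-yx-1)$, and let $W_q[[\hbar]]=\varprojlim_n W_q/\hbar^nW_q$ be its $\hbar$-adic completion. (Its elements are the formal series $\sum_r\hbar^r p_r$, where each $p_r$ is a pseudopolynomial, that is, a $k$-linear combination of monomials $x^iy^j$.) For an algebra $A$ over a commutative ring $R$ let $H^n(A,A)$ be its Hochschild cohomology over $R$ with coefficients in itself; here $R=k$ for $W_1$ and $R=k[[\hbar]]$ for $W_q$ and $W_q[[\hbar]]$. A class in $H^n(W_q,W_q)$ is called fragile at $q=1$ if its image in $H^n(W_q[[\hbar]],W_q[[\hbar]])$, obtained by extending cochains to the completion, is annihilated by some power of $\hbar$. The resilient cohomology of $W_q$ at $q=1$ is the quotient of $H^*(W_q,W_q)$ by the fragile classes. Then: (1) $W_1[[\hbar]]$ and $W_q[[\hbar]]$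 are isomorphic as $k[[\hbar]]$-algebras. More precisely, for every $r\ge 0$ the quotient $a_r(\hbar)=\hbar^{r+1}/\bigl((1+\hbar)^{r+1}-1\bigr)$ lies in $k[[\hbar]]$, with $a_0=1$; the series $$z=y+\sum_{r\ge 1}a_r(\hbar)\,x^ry^{r+1}$$ converges $\hbar$-adically in $W_q[[\hbar]]$; it can also be written as $z=y+\sum_{r\ge1}\hbar^r\eta_r$ with pseudopolynomials $\eta_r$ with coefficients in $k$; it satisfies $xz-zx=1$; and there is an isomorphism of $k[[\hbar]]$-algebras $W_1[[\hbar]]\to W_q[[\hbar]]$ with $x\mapsto x$ and $y\mapsto z$. (2) $H^n(W_1,W_1)=0$ and $H^n(W_q[[\hbar]],W_q[[\hbar]])=0$ for all $n>0$. (3) For all $n>0$ every class in $H^n(W_q,W_q)$ is fragile at $q=1$, so that the resilient cohomology of $W_q$ at $q=1$ vanishes in positive degrees. In degree $0$ it consists exactly of the constants: the natural map from $k[[\hbar]]$ to it is bijective. -/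

import Mathlib

universe u v

noncomputable section


/-! ## The `q`-Weyl algebra -/

/-- The single defining relation `q x y - y x = 1`, where `x`, `y` are the free generators
`0`, `1`. -/
inductive QWeyl.Rel (R : Type u) [CommRing R] (q : R) :
    FreeAlgebra R (Fin 2) → FreeAlgebra R (Fin 2) → Prop
  | rel : QWeyl.Rel R q
      (q • (FreeAlgebra.ι R 0 * FreeAlgebra.ι R 1) - FreeAlgebra.ι R 1 * FreeAlgebra.ι R 0) 1

/-- The `q`-Weyl algebra `R{x, y} / (q x y - y x - 1)` over a commutative ring `R`, for `q : R`.
The (first) Weyl algebra is the case `q = 1`. -/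
def QWeyl (R : Type u) [CommRing R] (q : R) : Type u := RingQuot (QWeyl.Rel R q)

namespace QWeyl

variable (R : Type u) [CommRing R] (q : R)

instance : Ring (QWeyl R q) := inferInstanceAs (Ring (RingQuot (QWeyl.Rel R q)))

instance : Algebra R (QWeyl R q) := inferInstanceAs (Algebra R (RingQuot (QWeyl.Rel R q)))

/-- The generator `x`. -/
def x : QWeyl R q := RingQuot.mkAlgHom R (QWeyl.Rel R q) (FreeAlgebra.ι R 0)

/-- The generator `y`. -/
def y : QWeyl R q := RingQuot.mkAlgHom R (QWeyl.Rel R q) (FreeAlgebra.ι R 1)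

/-- For `k`-algebras `A` the ring `A[[ħ]]` is a `k[[ħ]]`-algebra through `k[[ħ]] → A[[ħ]]`;
Mathlib has this instance for commutative `A` only. -/
instance : Algebra (PowerSeries R) (PowerSeries (QWeyl R q)) :=
  (PowerSeries.map (algebraMap R (QWeyl R q))).toAlgebra' (by
    intro c f
    ext n
    simp only [PowerSeries.coeff_mul, PowerSeries.coeff_map]
    rw [← Finset.Nat.sum_antidiagonal_swap]
    exact Finset.sum_congr rfl fun p _ => Algebra.commutes _ _)

end QWeyl

/-! ## The `t`-adic completion of an algebra -/

section Completion

variable {R : Type u} [CommRing R] (t : R) (A : Type v) [Ring A] [Algebra R A]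

/-- The two-sided ideal `t ^ n A`. -/
def adicIdeal (n : ℕ) : Ideal A where
  carrier := {a | ∃ b : A, a = t ^ n • b}
  add_mem' := by
    rintro _ _ ⟨b, rfl⟩ ⟨c, rfl⟩
    exact ⟨b + c, (smul_add _ _ _).symm⟩
  zero_mem' := ⟨0, (smul_zero _).symm⟩
  smul_mem' := by
    rintro c _ ⟨b, rfl⟩
    exact ⟨c * b, by simp⟩

instance (n : ℕ) : (adicIdeal t A n).IsTwoSided where
  mul_mem_of_left := by
    rintro _ c ⟨b, rfl⟩
    exact ⟨b * c, by simp⟩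

theorem adicIdeal_anti {m n : ℕ} (h : m ≤ n) : adicIdeal t A n ≤ adicIdeal t A m := by
  rintro _ ⟨b, rfl⟩
  exact ⟨t ^ (n - m) • b, by rw [smul_smul, ← pow_add, Nat.add_sub_cancel' h]⟩

/-- The `t`-adic completion `lim A / t ^ n A` of an `R`-algebra `A`, as the algebra of coherent
sequences in `∏ n, A / t ^ n A`. -/
def adicCompletionSubalgebra : Subalgebra R (∀ n : ℕ, A ⧸ adicIdeal t A n) where
  carrier := {a | ∀ (m n : ℕ) (h : m ≤ n),
    Ideal.Quotient.factor (adicIdeal_anti t A h) (a n) = a m}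
  mul_mem' := fun ha hb m n h => by
    rw [Pi.mul_apply, map_mul, ha m n h, hb m n h, Pi.mul_apply]
  add_mem' := fun ha hb m n h => by
    rw [Pi.add_apply, map_add, ha m n h, hb m n h, Pi.add_apply]
  algebraMap_mem' := fun _ _ _ _ => rfl

/-- The `t`-adic completion of the `R`-algebra `A`. -/
abbrev AdicAlgebra : Type v := adicCompletionSubalgebra t A

namespace AdicAlgebra

variable {A}

/-- The canonical map from `A` to its `t`-adic completion. -/
def of : A →ₐ[R] AdicAlgebra t A where
  toFun a := ⟨fun n => Ideal.Quotient.mk (adicIdeal t A n) a, fun _ _ _ => rfl⟩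
  map_one' := rfl
  map_mul' _ _ := rfl
  map_zero' := rfl
  map_add' _ _ := rfl
  commutes' _ := rfl

variable {t}

/-- The series `∑ u r` with terms in `A` converges `t`-adically to `z` in the completion:
modulo each `t ^ n`, all late partial sums equal `z`. -/
def HasSum (u : ℕ → A) (z : AdicAlgebra t A) : Prop :=
  ∀ n : ℕ, ∀ᶠ N in Filter.atTop,
    z.1 n = Ideal.Quotient.mk (adicIdeal t A n) (∑ r ∈ Finset.range N, u r)

end AdicAlgebra

end Completion

/-! ## The algebras `W₁`, `W_q` and `W_q[[ħ]]` for `q = 1 + ħ` -/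

section Specialize

variable (k : Type u) [Field k]

/-- The formal deformation parameter `ħ`, the variable of `k[[ħ]]`. -/
abbrev hbar : PowerSeries k := PowerSeries.X

/-- The first Weyl algebra `W₁ = k{x, y} / (x y - y x - 1)`. -/
abbrev W1 : Type u := QWeyl k 1

/-- The algebra `W_q` with `q = 1 + ħ`, with coefficients in `k[[ħ]]`. -/
abbrev Wq : Type u := QWeyl (PowerSeries k) (1 + hbar k)

/-- The algebra `W_q[[ħ]]` with `q = 1 + ħ`: the `ħ`-adic completion of `W_q`. Its elements are
the formal series `∑ ħ ^ r p_r` with `p_r` pseudopolynomials in `x`, `y` over `k`, multiplied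
according to `(1 + ħ) x y - y x = 1`. -/
abbrev WqHat : Type u := AdicAlgebra (hbar k) (Wq k)

/-- The generator `x` of `W_q`. -/
abbrev xq : Wq k := QWeyl.x (PowerSeries k) (1 + hbar k)

/-- The generator `y` of `W_q`. -/
abbrev yq : Wq k := QWeyl.y (PowerSeries k) (1 + hbar k)

variable {k}

/-- A pseudopolynomial with coefficients in `k`, as an element of `W_q`. -/
def pseudopolyWq (c : ℕ × ℕ →₀ k) : Wq k :=
  c.sum fun p b => PowerSeries.C b • (xq k ^ p.1 * yq k ^ p.2)

end Specialize

/-! ## Hochschild cohomology of an algebra with coefficients in itself -/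

section Hochschild

variable (R : Type u) [CommRing R] (A : Type v) [Ring A] [Algebra R A]

/-- Hochschild `n`-cochains: `R`-multilinear maps `A ^ n → A`. -/
def HochschildCochain (n : ℕ) : Type v := MultilinearMap R (fun _ : Fin n => A) A

namespace HochschildCochain

variable (n : ℕ)

instance : AddCommGroup (HochschildCochain R A n) :=
  inferInstanceAs (AddCommGroup (MultilinearMap R (fun _ : Fin n => A) A))

instance : Module R (HochschildCochain R A n) :=
  inferInstanceAs (Module R (MultilinearMap R (fun _ : Fin n => A) A))

instance : FunLike (HochschildCochain R A n) (Fin n → A) A :=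
  inferInstanceAs (FunLike (MultilinearMap R (fun _ : Fin n => A) A) (Fin n → A) A)

variable {R A n}

/-- A cochain as a multilinear map. -/
def toMultilinearMap (f : HochschildCochain R A n) : MultilinearMap R (fun _ : Fin n => A) A := f

theorem zero_apply (a : Fin n → A) : (0 : HochschildCochain R A n) a = 0 := rfl

theorem add_apply (f g : HochschildCochain R A n) (a : Fin n → A) : (f + g) a = f a + g a := rfl

theorem smul_apply (r : R) (f : HochschildCochain R A n) (a : Fin n → A) :
    (r • f) a = r • f a := rfl

theorem map_update_add (f : HochschildCochain R A n) (a : Fin n → A) (i : Fin n) (b c : A) :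
    f (Function.update a i (b + c)) = f (Function.update a i b) + f (Function.update a i c) :=
  MultilinearMap.map_update_add f.toMultilinearMap a i b c

theorem map_update_smul (f : HochschildCochain R A n) (a : Fin n → A) (i : Fin n) (r : R) (b : A) :
    f (Function.update a i (r • b)) = r • f (Function.update a i b) :=
  MultilinearMap.map_update_smul f.toMultilinearMap a i r b

theorem map_update_sub (f : HochschildCochain R A n) (a : Fin n → A) (i : Fin n) (b c : A) :
    f (Function.update a i (b - c)) = f (Function.update a i b) - f (Function.update a i c) :=
  MultilinearMap.map_update_sub f.toMultilinearMap a i b c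

end HochschildCochain

variable {R A}

/-- The Hochschild coboundary of `f`, evaluated at `(a 0, …, a n)`:
`a 0 * f (a 1, …, a n) + ∑ j < n, (-1) ^ (j + 1) f (…, a j * a (j + 1), …)
  + (-1) ^ (n + 1) f (a 0, …, a (n - 1)) * a n`. -/
def hochschildD {n : ℕ} (f : HochschildCochain R A n) (a : Fin (n + 1) → A) : A :=
  a 0 * f (fun i => a i.succ)
    + ∑ j : Fin n, (-1 : A) ^ ((j : ℕ) + 1) * f (Fin.contractNth j.castSucc (· * ·) a)
    + (-1 : A) ^ (n + 1) * (f (fun i => a i.castSucc) * a (Fin.last n))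

theorem hochschildD_zero {n : ℕ} (a : Fin (n + 1) → A) :
    hochschildD (0 : HochschildCochain R A n) a = 0 := by
  simp [hochschildD, HochschildCochain.zero_apply]

theorem hochschildD_add {n : ℕ} (f g : HochschildCochain R A n) (a : Fin (n + 1) → A) :
    hochschildD (f + g) a = hochschildD f a + hochschildD g a := by
  simp only [hochschildD, HochschildCochain.add_apply, mul_add, add_mul, Finset.sum_add_distrib]
  abel

theorem hochschildD_smul {n : ℕ} (r : R) (f : HochschildCochain R A n) (a : Fin (n + 1) → A) :
    hochschildD (r • f) a = r • hochschildD f a := by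
  simp only [hochschildD, HochschildCochain.smul_apply, mul_smul_comm, smul_mul_assoc, smul_add,
    Finset.smul_sum]

variable (R A)

/-- Hochschild `n`-cocycles. -/
def hochschildCocycles (n : ℕ) : Submodule R (HochschildCochain R A n) where
  carrier := {f | ∀ a, hochschildD f a = 0}
  zero_mem' := hochschildD_zero
  add_mem' := fun hf hg a => by rw [hochschildD_add, hf a, hg a, add_zero]
  smul_mem' := fun r _ hf a => by rw [hochschildD_smul, hf a, smul_zero]

/-- Hochschild `n`-coboundaries; there are no nonzero ones for `n = 0`. -/
def hochschildCoboundaries : (n : ℕ) → Submodule R (HochschildCochain R A n)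
  | 0 => ⊥
  | n + 1 =>
    { carrier := {f | ∃ g : HochschildCochain R A n, ∀ a, f a = hochschildD g a}
      zero_mem' := ⟨0, fun a => (hochschildD_zero a).symm⟩
      add_mem' := by
        rintro _ _ ⟨g, hg⟩ ⟨h, hh⟩
        exact ⟨g + h, fun a => by rw [hochschildD_add, HochschildCochain.add_apply, hg, hh]⟩
      smul_mem' := by
        rintro r _ ⟨g, hg⟩
        exact ⟨r • g, fun a => by rw [hochschildD_smul, HochschildCochain.smul_apply, hg]⟩ }

/-- The Hochschild cohomology `H ^ n (A, A)` of the `R`-algebra `A`: cocycles modulo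
coboundaries. -/
abbrev HochschildCohomology (n : ℕ) : Type v :=
  hochschildCocycles R A n ⧸ (hochschildCoboundaries R A n).submoduleOf (hochschildCocycles R A n)

/-- The `0`-cochain with value `b`. -/
def HochschildCochain.const (b : A) : HochschildCochain R A 0 :=
  MultilinearMap.constOfIsEmpty R (fun _ : Fin 0 => A) b

theorem HochschildCochain.const_apply (b : A) (a : Fin 0 → A) :
    HochschildCochain.const R A b a = b := rfl

/-- The map from the constants `R` to `H ^ 0 (A, A)` (which is the center of `A`): the scalar `r`
goes to the class of the `0`-cocycle with value `r • 1`. -/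
def HochschildCohomology.const : R →ₗ[R] HochschildCohomology R A 0 :=
  Submodule.mkQ _ ∘ₗ
    { toFun := fun r =>
        ⟨HochschildCochain.const R A (algebraMap R A r), fun a => by
          simp [hochschildD, HochschildCochain.const_apply, Algebra.commutes r (a 0)]⟩
      map_add' := fun r s => Subtype.ext (DFunLike.ext _ _ fun a => map_add (algebraMap R A) r s)
      map_smul' := fun r s => Subtype.ext (DFunLike.ext _ _ fun a =>
        (map_mul (algebraMap R A) r s).trans (Algebra.smul_def r (algebraMap R A s)).symm) }

end Hochschild

/-! ## From the cohomology of an algebra to that of its completion -/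

section Fragile

variable {R : Type u} [CommRing R] (t : R) {A : Type v} [Ring A] [Algebra R A]

theorem HochschildCochain.congr_mod {n : ℕ} (f : HochschildCochain R A n) (m : ℕ)
    {a b : Fin n → A}
    (h : ∀ i, Ideal.Quotient.mk (adicIdeal t A m) (a i)
      = Ideal.Quotient.mk (adicIdeal t A m) (b i)) :
    Ideal.Quotient.mk (adicIdeal t A m) (f a) = Ideal.Quotient.mk (adicIdeal t A m) (f b) := by
  classical
  have key : ∀ s : Finset (Fin n),
      Ideal.Quotient.mk (adicIdeal t A m) (f (s.piecewise a b))
        = Ideal.Quotient.mk (adicIdeal t A m) (f b) := by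
    intro s
    induction s using Finset.induction_on with
    | empty => simp
    | insert i s hi ih =>
      rw [← ih, Ideal.Quotient.eq, Finset.piecewise_insert]
      obtain ⟨c, hc⟩ := Ideal.Quotient.eq.1 (h i)
      have e : s.piecewise a b = Function.update (s.piecewise a b) i (b i) := by
        rw [eq_comm, Function.update_eq_self_iff, Finset.piecewise_eq_of_notMem _ _ _ hi]
      refine ⟨f (Function.update (s.piecewise a b) i c), ?_⟩
      rw [← f.map_update_smul, ← hc, f.map_update_sub, ← e]
  simpa using key Finset.univ

/-- The unique extension of a cochain on `A` to the `t`-adic completion of `A`: modulo `t ^ m` it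
is the cochain on `A / t ^ m A` induced by `f`. -/
def HochschildCochain.completeFun {n : ℕ} (f : HochschildCochain R A n)
    (a : Fin n → AdicAlgebra t A) : AdicAlgebra t A :=
  ⟨fun m => Ideal.Quotient.mk (adicIdeal t A m) (f fun i => Quotient.out ((a i).1 m)), by
    intro m m' h
    rw [Ideal.Quotient.factor_mk]
    refine f.congr_mod t m fun i => ?_
    have e : ∀ (j : ℕ) (z : A ⧸ adicIdeal t A j),
      Ideal.Quotient.mk (adicIdeal t A j) (Quotient.out z) = z := fun _ z => Quotient.out_eq z
    rw [e, ← (a i).2 m m' h, ← Ideal.Quotient.factor_mk (adicIdeal_anti t A h), e]⟩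

theorem HochschildCochain.completeFun_val {n : ℕ} (f : HochschildCochain R A n)
    (a : Fin n → AdicAlgebra t A) (m : ℕ) (x : Fin n → A)
    (h : ∀ i, (a i).1 m = Ideal.Quotient.mk (adicIdeal t A m) (x i)) :
    (f.completeFun t a).1 m = Ideal.Quotient.mk (adicIdeal t A m) (f x) :=
  f.congr_mod t m fun i => (Quotient.out_eq ((a i).1 m)).trans (h i)

theorem AdicAlgebra.exists_rep {n : ℕ} (a : Fin n → AdicAlgebra t A) (m : ℕ) :
    ∃ x : Fin n → A, ∀ i, (a i).1 m = Ideal.Quotient.mk (adicIdeal t A m) (x i) :=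
  ⟨fun i => Quotient.out ((a i).1 m), fun i => (Quotient.out_eq ((a i).1 m)).symm⟩

/-- Completion of cochains, as a linear map. -/
def HochschildCochain.complete (n : ℕ) :
    HochschildCochain R A n →ₗ[R] HochschildCochain R (AdicAlgebra t A) n where
  toFun f := MultilinearMap.mk' (f.completeFun t)
    (by
      intro a i b c
      refine Subtype.ext (funext fun m => ?_)
      obtain ⟨x, hx⟩ := AdicAlgebra.exists_rep t a m
      obtain ⟨p, hp⟩ := Ideal.Quotient.mk_surjective (b.1 m)
      obtain ⟨r, hr⟩ := Ideal.Quotient.mk_surjective (c.1 m)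
      have H : ∀ (d : AdicAlgebra t A) (s : A), d.1 m = Ideal.Quotient.mk (adicIdeal t A m) s →
          (f.completeFun t (Function.update a i d)).1 m
            = Ideal.Quotient.mk (adicIdeal t A m) (f (Function.update x i s)) := by
        intro d s hd
        refine f.completeFun_val t _ m _ fun j => ?_
        rcases eq_or_ne j i with rfl | hj
        · simpa using hd
        · simpa [hj] using hx j
      rw [H (b + c) (p + r) (by rw [map_add, hp, hr]; rfl), f.map_update_add, map_add,
        ← H b p hp.symm, ← H c r hr.symm]
      rfl)
    (by
      intro a i s b
      refine Subtype.ext (funext fun m => ?_)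
      obtain ⟨x, hx⟩ := AdicAlgebra.exists_rep t a m
      obtain ⟨p, hp⟩ := Ideal.Quotient.mk_surjective (b.1 m)
      have H : ∀ (d : AdicAlgebra t A) (s : A), d.1 m = Ideal.Quotient.mk (adicIdeal t A m) s →
          (f.completeFun t (Function.update a i d)).1 m
            = Ideal.Quotient.mk (adicIdeal t A m) (f (Function.update x i s)) := by
        intro d s hd
        refine f.completeFun_val t _ m _ fun j => ?_
        rcases eq_or_ne j i with rfl | hj
        · simpa using hd
        · simpa [hj] using hx j
      have e : (s • b).1 m = Ideal.Quotient.mk (adicIdeal t A m) (s • p) := by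
        change s • b.1 m = _
        rw [← hp]
        rfl
      rw [H (s • b) (s • p) e, f.map_update_smul]
      change _ = s • (f.completeFun t (Function.update a i b)).1 m
      rw [H b p hp.symm]
      rfl)
  map_add' _ _ := rfl
  map_smul' _ _ := rfl

theorem hochschildD_complete {n : ℕ} (f : HochschildCochain R A n)
    (a : Fin (n + 1) → AdicAlgebra t A) (m : ℕ) (x : Fin (n + 1) → A)
    (h : ∀ i, (a i).1 m = Ideal.Quotient.mk (adicIdeal t A m) (x i)) :
    (hochschildD (HochschildCochain.complete t n f) a).1 m
      = Ideal.Quotient.mk (adicIdeal t A m) (hochschildD f x) := by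
  have hc : ∀ (b : Fin n → AdicAlgebra t A) (w : Fin n → A),
      (∀ i, (b i).1 m = Ideal.Quotient.mk (adicIdeal t A m) (w i)) →
      (HochschildCochain.complete t n f b).1 m = Ideal.Quotient.mk (adicIdeal t A m) (f w) :=
    fun b w hb => f.completeFun_val t b m w hb
  let ev : AdicAlgebra t A →+* A ⧸ adicIdeal t A m :=
    (Pi.evalRingHom (fun j => A ⧸ adicIdeal t A j) m).comp
      (adicCompletionSubalgebra t A).val.toRingHom
  change ev (hochschildD (HochschildCochain.complete t n f) a) = _
  have hc' : ∀ (b : Fin n → AdicAlgebra t A) (w : Fin n → A),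
      (∀ i, ev (b i) = Ideal.Quotient.mk (adicIdeal t A m) (w i)) →
      ev (HochschildCochain.complete t n f b) = Ideal.Quotient.mk (adicIdeal t A m) (f w) := hc
  have h' : ∀ i, ev (a i) = Ideal.Quotient.mk (adicIdeal t A m) (x i) := h
  simp only [hochschildD, map_add, map_mul, map_sum, map_pow, map_neg, map_one, h']
  rw [hc' _ (fun i => x i.succ) fun i => h' _, hc' _ (fun i => x i.castSucc) fun i => h' _]
  congr 2
  refine Finset.sum_congr rfl fun j _ => ?_
  rw [hc' _ (Fin.contractNth j.castSucc (· * ·) x)]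
  intro i
  unfold Fin.contractNth
  split_ifs <;> simp [h']

/-- Completion of cocycles. -/
def hochschildCocycles.complete (n : ℕ) :
    hochschildCocycles R A n →ₗ[R] hochschildCocycles R (AdicAlgebra t A) n :=
  (HochschildCochain.complete t n).restrict fun f hf a => Subtype.ext (funext fun m => by
    obtain ⟨x, hx⟩ := AdicAlgebra.exists_rep t a m
    rw [hochschildD_complete t f a m x hx, hf x, map_zero]
    rfl)

theorem hochschildCoboundaries_complete : ∀ (n : ℕ), ∀ f ∈ hochschildCoboundaries R A n,
    HochschildCochain.complete t n f ∈ hochschildCoboundaries R (AdicAlgebra t A) n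
  | 0, f, hf => by
    obtain rfl : f = 0 := hf
    rw [map_zero]
    exact Submodule.zero_mem _
  | n + 1, f, ⟨g, hg⟩ => ⟨HochschildCochain.complete t n g, fun a =>
      Subtype.ext (funext fun m => by
        obtain ⟨x, hx⟩ := AdicAlgebra.exists_rep t a m
        rw [hochschildD_complete t g a m x hx, ← hg x]
        exact f.completeFun_val t a m x hx)⟩

variable (A)

/-- The map `H ^ n (A, A) → H ^ n (Â, Â)` induced by extending cochains to the `t`-adic
completion `Â` of `A`. -/
def HochschildCohomology.complete (n : ℕ) :
    HochschildCohomology R A n →ₗ[R] HochschildCohomology R (AdicAlgebra t A) n :=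
  Submodule.mapQ _ _ (hochschildCocycles.complete t n) fun f hf =>
    hochschildCoboundaries_complete t n f.1 hf

/-- The fragile classes in `H ^ n (A, A)` at the specialization `t = 0`: those which become
`t`-power torsion classes in the cohomology of the completion, and hence vanish there once
`t⁻¹` is adjoined to the coefficients. -/
def fragileClasses (n : ℕ) : Submodule R (HochschildCohomology R A n) where
  carrier := {c | ∃ m : ℕ, t ^ m • HochschildCohomology.complete t A n c = 0}
  zero_mem' := ⟨0, by simp⟩
  add_mem' := by
    rintro c d ⟨i, hi⟩ ⟨j, hj⟩
    refine ⟨i + j, ?_⟩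
    rw [map_add, smul_add, pow_add, mul_smul, mul_smul, hj, smul_zero, add_zero, smul_comm, hi,
      smul_zero]
  smul_mem' := by
    rintro r c ⟨i, hi⟩
    exact ⟨i, by rw [map_smul, smul_comm, hi, smul_zero]⟩

/-- The resilient cohomology at the specialization `t = 0`, in degree `n`: the quotient of
`H ^ n (A, A)` by the fragile classes. -/
abbrev ResilientCohomology (n : ℕ) : Type v := HochschildCohomology R A n ⧸ fragileClasses t A n

end Fragile

end

/-!
# Resilient cohomology of the `q`-Weyl algebra

Normal ordering makes the monomials `x ^ i y ^ j` a basis of the `q`-Weyl algebra over any ring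
(`QWeyl.basis`).

*Trivialization.* From `y ^ n x = q ^ n x y ^ n - [n]_q y ^ (n - 1)` the commutator of `x` with
`a_r x ^ r y ^ (r + 1)` is `ħ ^ r x ^ r y ^ r - ħ ^ (r + 1) x ^ (r + 1) y ^ (r + 1)`, so the sum `z`
of these terms satisfies `x z - z x = 1` by telescoping. Hence there is a homomorphism
`W₁[[ħ]] → W_q[[ħ]]` with `x ↦ x`, `y ↦ z`. Modulo `ħ` it matches the two bases; as the target is
complete and torsion-free, it is bijective (`exists_trivialization`).

*Cohomology of `W₁`.* Derivations are inner, since differentiation in `x` and in `y`, which are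
the commutators with `y` and `x`, can be inverted by formal integration (`QWeyl.exists_inner`). In
degree two, a cocycle with coefficients in `M` defines an extension of `W₁` by `M`; it splits as
soon as `x` and `y` can be lifted to elements with commutator `1`, which is possible if every
element of `M` has the form `[x, v] - [y, u]` (`HochschildCoeff.exists_primitive_two`). In higher
degrees one curries the last argument of a cocycle, which passes from `M` to linear maps `W₁ → M`
with a twisted right action. This module always has the property required in degree two, because
`W₁` is free as a left module over `k[x]` (`HochschildCoeff.koszulSurjective_twist`), so
induction on the degree applies. The twisted right action is not unital, and the degree
two argument does not need it to be.

*Cohomology of `W_q[[ħ]]`.* By the trivialization this is the cohomology of `W₁[[ħ]]` over `k[[ħ]]`.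
A cochain there is determined by its restriction to `W₁`, that is by a formal power series of
cochains of `W₁`, so the vanishing for `W₁` applies coefficient by coefficient
(`QWeyl.exists_primitive_powerSeries`).

*Fragile classes.* In positive degrees all classes of `W_q` die in the completion. In degree zero
the cohomology is the center. A central element of `W_q` is central in `W_q[[ħ]] ≃ W₁[[ħ]]`, so its
coefficients lie in the center of `W₁`, which is `k`; and no nonzero constant is fragile.
-/

universe w

noncomputable section

/-! ### Normal ordering in the `q`-Weyl algebra -/

namespace QWeyl

variable {R : Type u} [CommRing R] {q : R}

theorem relation : q • (x R q * y R q) - y R q * x R q = 1 := by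
  have h := RingQuot.mkAlgHom_rel R (Rel.rel (R := R) (q := q))
  rw [map_sub, map_smul, map_mul, map_mul, map_one] at h
  exact h

theorem y_mul_x : y R q * x R q = q • (x R q * y R q) - 1 := by
  rw [← relation (R := R) (q := q), sub_sub_cancel]

/-- The universal property of the `q`-Weyl algebra. -/
def lift {S : Type v} [Ring S] [Algebra R S] (X Y : S) (h : q • (X * Y) - Y * X = 1) :
    QWeyl R q →ₐ[R] S :=
  RingQuot.liftAlgHom R ⟨FreeAlgebra.lift R ![X, Y], by rintro _ _ ⟨⟩; simpa using h⟩

section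

variable {S : Type v} [Ring S] [Algebra R S] {X Y : S} (h : q • (X * Y) - Y * X = 1)

@[simp]
theorem lift_x : lift X Y h (x R q) = X :=
  (RingQuot.liftAlgHom_mkAlgHom_apply R (FreeAlgebra.lift R ![X, Y])
    (s := Rel R q) _ _).trans (by simp)

@[simp]
theorem lift_y : lift X Y h (y R q) = Y :=
  (RingQuot.liftAlgHom_mkAlgHom_apply R (FreeAlgebra.lift R ![X, Y])
    (s := Rel R q) _ _).trans (by simp)

end

theorem induction {P : QWeyl R q → Prop} (scalar : ∀ r, P (algebraMap R _ r))
    (gen_x : P (x R q)) (gen_y : P (y R q)) (mul : ∀ a b, P a → P b → P (a * b))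
    (add : ∀ a b, P a → P b → P (a + b)) (a : QWeyl R q) : P a := by
  obtain ⟨a, rfl⟩ := RingQuot.mkAlgHom_surjective R (Rel R q) a
  induction a using FreeAlgebra.induction with
  | grade0 r => rw [AlgHom.commutes]; exact scalar r
  | grade1 i =>
    fin_cases i
    · exact gen_x
    · exact gen_y
  | mul a b ha hb => rw [map_mul]; exact mul _ _ ha hb
  | add a b ha hb => rw [map_add]; exact add _ _ ha hb

/-- The `q`-integer `1 + q + ⋯ + q ^ (n - 1)`. -/
def qInt (q : R) (n : ℕ) : R := ∑ i ∈ Finset.range n, q ^ i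

@[simp]
theorem qInt_zero : qInt q 0 = 0 := rfl

theorem qInt_succ (n : ℕ) : qInt q (n + 1) = q * qInt q n + 1 := by
  simp [qInt, Finset.sum_range_succ', Finset.mul_sum, pow_succ']

theorem qInt_succ' (n : ℕ) : qInt q (n + 1) = qInt q n + q ^ n :=
  Finset.sum_range_succ _ _

@[simp]
theorem qInt_one (n : ℕ) : qInt (1 : R) n = n := by simp [qInt]

theorem y_mul_x_pow (i : ℕ) :
    y R q * x R q ^ i = q ^ i • (x R q ^ i * y R q) - qInt q i • x R q ^ (i - 1) := by
  induction i with
  | zero => simp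
  | succ i ih =>
    have e : qInt q i • (x R q ^ (i - 1) * x R q) = qInt q i • x R q ^ i := by
      cases i <;> simp [pow_succ]
    rw [pow_succ (x R q), ← mul_assoc, ih, sub_mul, smul_mul_assoc, smul_mul_assoc, e, mul_assoc,
      y_mul_x, mul_sub, mul_smul_comm, ← mul_assoc, ← pow_succ]
    rw [qInt_succ', Nat.add_sub_cancel, smul_sub, smul_smul, ← pow_succ, add_smul, mul_one]
    abel

theorem y_pow_mul_x (j : ℕ) :
    y R q ^ j * x R q = q ^ j • (x R q * y R q ^ j) - qInt q j • y R q ^ (j - 1) := by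
  induction j with
  | zero => simp
  | succ j ih =>
    have e : qInt q j • (y R q * y R q ^ (j - 1)) = qInt q j • y R q ^ j := by
      cases j <;> simp [pow_succ']
    rw [pow_succ' (y R q), mul_assoc, ih, mul_sub, mul_smul_comm, mul_smul_comm, e, ← mul_assoc,
      y_mul_x, sub_mul, smul_mul_assoc, mul_assoc, ← pow_succ']
    rw [qInt_succ', Nat.add_sub_cancel, smul_sub, smul_smul, ← pow_succ, add_smul, one_mul]
    abel

/-- Left multiplication by `x` on normally ordered polynomials, as a map of their coefficients. -/
def opX (R : Type u) [CommRing R] : (ℕ × ℕ →₀ R) →ₗ[R] (ℕ × ℕ →₀ R) :=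
  Finsupp.linearCombination R fun p => Finsupp.single (p.1 + 1, p.2) 1

/-- Left multiplication by `y` on normally ordered polynomials, as a map of their coefficients:
it comes from `y x ^ i = q ^ i x ^ i y - [i]_q x ^ (i - 1)`. -/
def opY (q : R) : (ℕ × ℕ →₀ R) →ₗ[R] (ℕ × ℕ →₀ R) :=
  Finsupp.linearCombination R fun p =>
    q ^ p.1 • Finsupp.single (p.1, p.2 + 1) 1 - qInt q p.1 • Finsupp.single (p.1 - 1, p.2) 1

@[simp]
theorem opX_single (p : ℕ × ℕ) :
    opX R (Finsupp.single p 1) = Finsupp.single (p.1 + 1, p.2) 1 := by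
  simp [opX]

@[simp]
theorem opY_single (p : ℕ × ℕ) : opY q (Finsupp.single p 1) =
    q ^ p.1 • Finsupp.single (p.1, p.2 + 1) 1 - qInt q p.1 • Finsupp.single (p.1 - 1, p.2) 1 := by
  rw [opY, Finsupp.linearCombination_single, one_smul]

theorem opX_opY : q • (opX R * opY q) - opY q * opX R = 1 := by
  refine Finsupp.lhom_ext' fun p => LinearMap.ext_ring ?_
  have e : qInt q p.1 • Finsupp.single (p.1 - 1 + 1, p.2) (1 : R)
      = qInt q p.1 • Finsupp.single p (1 : R) := by
    obtain ⟨i, j⟩ := p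
    cases i <;> simp
  simp only [LinearMap.comp_apply, Finsupp.lsingle_apply, LinearMap.sub_apply,
    LinearMap.smul_apply, Module.End.mul_apply, Module.End.one_apply, opX_single, opY_single,
    map_sub, map_smul, e, qInt_succ, Nat.add_sub_cancel, smul_sub, smul_smul, add_smul, one_smul,
    pow_succ']
  abel

/-- The linear combination of the ordered monomials `x ^ i y ^ j` with given coefficients. -/
def ofCoeffs (q : R) : (ℕ × ℕ →₀ R) →ₗ[R] QWeyl R q :=
  Finsupp.linearCombination R fun p => x R q ^ p.1 * y R q ^ p.2

@[simp]
theorem ofCoeffs_single (p : ℕ × ℕ) (r : R) :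
    ofCoeffs q (Finsupp.single p r) = r • (x R q ^ p.1 * y R q ^ p.2) := by
  simp [ofCoeffs]

theorem ofCoeffs_opX (c : ℕ × ℕ →₀ R) : ofCoeffs q (opX R c) = x R q * ofCoeffs q c := by
  induction c using Finsupp.induction_linear with
  | zero => simp
  | add a b ha hb => simp only [map_add, ha, hb, mul_add]
  | single p r =>
    rw [← mul_one r, ← smul_eq_mul, ← Finsupp.smul_single, map_smul, map_smul, map_smul, opX_single,
      ofCoeffs_single, ofCoeffs_single, one_smul, one_smul, mul_smul_comm, ← mul_assoc, pow_succ']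

theorem ofCoeffs_opY (c : ℕ × ℕ →₀ R) : ofCoeffs q (opY q c) = y R q * ofCoeffs q c := by
  induction c using Finsupp.induction_linear with
  | zero => simp
  | add a b ha hb => simp only [map_add, ha, hb, mul_add]
  | single p r =>
    rw [← mul_one r, ← smul_eq_mul, ← Finsupp.smul_single, map_smul, map_smul, map_smul, opY_single,
      map_sub, map_smul, map_smul]
    simp only [ofCoeffs_single, one_smul, mul_smul_comm]
    rw [← mul_assoc, y_mul_x_pow, sub_mul, smul_mul_assoc, smul_mul_assoc, mul_assoc, pow_succ']

/-- The action of the `q`-Weyl algebra on normally ordered polynomials. -/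
def rep (q : R) : QWeyl R q →ₐ[R] Module.End R (ℕ × ℕ →₀ R) :=
  lift (opX R) (opY q) opX_opY

theorem ofCoeffs_rep (a : QWeyl R q) :
    ∀ c : ℕ × ℕ →₀ R, ofCoeffs q (rep q a c) = a * ofCoeffs q c := by
  induction a using induction with
  | scalar r => intro c; simp [Algebra.algebraMap_eq_smul_one]
  | gen_x => intro c; rw [rep, lift_x, ofCoeffs_opX]
  | gen_y => intro c; rw [rep, lift_y, ofCoeffs_opY]
  | mul a b ha hb => intro c; rw [map_mul, Module.End.mul_apply, ha, hb, mul_assoc]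
  | add a b ha hb => intro c; rw [map_add, LinearMap.add_apply, map_add, ha, hb, add_mul]

theorem opY_pow (j : ℕ) : (opY q ^ j) (Finsupp.single (0, 0) 1) = Finsupp.single (0, j) 1 := by
  induction j with
  | zero => simp
  | succ j ih => rw [pow_succ', Module.End.mul_apply, ih]; simp

theorem opX_pow (i : ℕ) (j : ℕ) :
    (opX R ^ i) (Finsupp.single (0, j) 1) = Finsupp.single (i, j) 1 := by
  induction i with
  | zero => simp
  | succ j ih => rw [pow_succ', Module.End.mul_apply, ih]; simp

/-- The ordered monomials `x ^ i y ^ j` form a basis. They span because their span is stable under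
left multiplication by `x` and `y`; they are independent because in the representation `rep` they
send the basis vector at `(0, 0)` to the one at `(i, j)`. -/
def basis (q : R) : Module.Basis (ℕ × ℕ) R (QWeyl R q) :=
  .ofRepr <| LinearEquiv.symm <| LinearEquiv.ofLinearMap (ofCoeffs q)
    ((LinearMap.applyₗ (Finsupp.single (0, 0) 1)).comp (rep q).toLinearMap)
    (LinearMap.ext fun a => by
      simp only [LinearMap.comp_apply, AlgHom.toLinearMap_apply, LinearMap.applyₗ_apply_apply,
        ofCoeffs_rep]
      simp)
    (Finsupp.lhom_ext' fun p => LinearMap.ext_ring <| by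
      simp only [LinearMap.comp_apply, AlgHom.toLinearMap_apply, LinearMap.applyₗ_apply_apply,
        Finsupp.lsingle_apply, ofCoeffs_single, one_smul, map_mul, map_pow, rep, lift_x, lift_y,
        Module.End.mul_apply, opY_pow, opX_pow, LinearMap.id_apply])

@[simp]
theorem basis_apply (p : ℕ × ℕ) : basis q p = x R q ^ p.1 * y R q ^ p.2 := by
  change ofCoeffs q (Finsupp.single p 1) = _
  simp

end QWeyl

/-! ### Commutators in the Weyl algebra -/

namespace QWeyl

section

variable {R : Type u} [CommRing R] {q : R}

@[simp]
theorem basis_repr_monomial (i j : ℕ) :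
    (basis q).repr (x R q ^ i * y R q ^ j) = Finsupp.single (i, j) 1 := by
  have := (basis q).repr_self (i, j)
  rwa [basis_apply] at this

theorem linearMap_ext {M : Type v} [AddCommGroup M] [Module R M] {f g : QWeyl R q →ₗ[R] M}
    (h : ∀ i j : ℕ, f (x R q ^ i * y R q ^ j) = g (x R q ^ i * y R q ^ j)) : f = g :=
  (basis q).ext fun p => by simpa using h p.1 p.2

end

variable {k : Type u} [Field k]

local notation "X" => x k (1 : k)
local notation "Y" => y k (1 : k)

theorem commutator_x_monomial (i j : ℕ) :
    X * (X ^ i * Y ^ j) - X ^ i * Y ^ j * X = (j : k) • (X ^ i * Y ^ (j - 1)) := by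
  rw [mul_assoc, y_pow_mul_x, one_pow, one_smul, qInt_one, mul_sub, mul_smul_comm, ← mul_assoc,
    ← mul_assoc, ← pow_succ', ← pow_succ]
  abel

theorem commutator_monomial_y (i j : ℕ) :
    X ^ i * Y ^ j * Y - Y * (X ^ i * Y ^ j) = (i : k) • (X ^ (i - 1) * Y ^ j) := by
  rw [← mul_assoc Y, y_mul_x_pow, one_pow, one_smul, qInt_one, sub_mul, smul_mul_assoc, mul_assoc,
    mul_assoc, ← pow_succ', ← pow_succ]
  abel

variable (k) in
/-- The part of a pseudopolynomial which does not involve `y`. -/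
def constY : W1 k →ₗ[k] W1 k :=
  (basis 1).constr k fun p => if p.2 = 0 then X ^ p.1 else 0

variable (k) in
/-- Formal integration in `y` of pseudopolynomials. -/
def integralY : W1 k →ₗ[k] W1 k :=
  (basis 1).constr k fun p => ((p.2 : k) + 1)⁻¹ • (X ^ p.1 * Y ^ (p.2 + 1))

variable (k) in
/-- Formal integration in `x` of pseudopolynomials. -/
def integralX : W1 k →ₗ[k] W1 k :=
  (basis 1).constr k fun p => ((p.1 : k) + 1)⁻¹ • (X ^ (p.1 + 1) * Y ^ p.2)

theorem constY_monomial (i j : ℕ) : constY k (X ^ i * Y ^ j) = if j = 0 then X ^ i else 0 := by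
  simpa [constY] using (basis (1 : k)).constr_basis k
    (fun p => if p.2 = 0 then X ^ p.1 else 0) (i, j)

theorem integralY_monomial (i j : ℕ) :
    integralY k (X ^ i * Y ^ j) = ((j : k) + 1)⁻¹ • (X ^ i * Y ^ (j + 1)) := by
  simpa [integralY] using (basis (1 : k)).constr_basis k
    (fun p => ((p.2 : k) + 1)⁻¹ • (X ^ p.1 * Y ^ (p.2 + 1))) (i, j)

theorem integralX_monomial (i j : ℕ) :
    integralX k (X ^ i * Y ^ j) = ((i : k) + 1)⁻¹ • (X ^ (i + 1) * Y ^ j) := by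
  simpa [integralX] using (basis (1 : k)).constr_basis k
    (fun p => ((p.1 : k) + 1)⁻¹ • (X ^ (p.1 + 1) * Y ^ p.2)) (i, j)

variable (k) in
/-- The derivation `a ↦ x a - a x`, which is differentiation in `y`. -/
def adX : W1 k →ₗ[k] W1 k := LinearMap.mulLeft k X - LinearMap.mulRight k X

variable (k) in
/-- The derivation `a ↦ a y - y a`, which is differentiation in `x`. -/
def adY : W1 k →ₗ[k] W1 k := LinearMap.mulRight k Y - LinearMap.mulLeft k Y

theorem adX_apply (a : W1 k) : adX k a = X * a - a * X := rfl

theorem adY_apply (a : W1 k) : adY k a = a * Y - Y * a := rfl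

theorem adX_integralX_constY (a : W1 k) : adX k (integralX k (constY k a)) = 0 := by
  have : adX k ∘ₗ integralX k ∘ₗ constY k = 0 := linearMap_ext fun i j => by
    rw [LinearMap.comp_apply, LinearMap.comp_apply, constY_monomial]
    split_ifs
    · have := integralX_monomial (k := k) i 0
      simp only [pow_zero, mul_one] at this
      rw [this, map_smul, adX_apply]
      simp [← pow_succ, ← pow_succ']
    · simp
  exact LinearMap.congr_fun this a

section

variable [CharZero k]

theorem adX_integralY (a : W1 k) : adX k (integralY k a) = a := by
  have : adX k ∘ₗ integralY k = LinearMap.id := linearMap_ext fun i j => by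
    have h : (j : k) + 1 ≠ 0 := by exact_mod_cast j.succ_ne_zero
    rw [LinearMap.comp_apply, integralY_monomial, map_smul, adX_apply, commutator_x_monomial,
      Nat.cast_add_one, inv_smul_smul₀ h]
    rfl
  exact LinearMap.congr_fun this a

theorem integralY_adX (a : W1 k) : integralY k (adX k a) = a - constY k a := by
  have : integralY k ∘ₗ adX k = LinearMap.id - constY k := linearMap_ext fun i j => by
    rw [LinearMap.comp_apply, adX_apply, commutator_x_monomial, map_smul, integralY_monomial,
      LinearMap.sub_apply, LinearMap.id_apply, constY_monomial]
    cases j with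
    | zero => simp
    | succ j =>
      have h : (j : k) + 1 ≠ 0 := by exact_mod_cast j.succ_ne_zero
      rw [Nat.cast_add_one, Nat.add_sub_cancel, smul_inv_smul₀ h]
      simp
  exact LinearMap.congr_fun this a

theorem constY_of_adX_eq_zero {a : W1 k} (h : adX k a = 0) : constY k a = a := by
  have := integralY_adX a
  rw [h, map_zero] at this
  exact (sub_eq_zero.1 this.symm).symm

theorem adY_integralX (a : W1 k) : adY k (integralX k a) = a := by
  have : adY k ∘ₗ integralX k = LinearMap.id := linearMap_ext fun i j => by
    have h : (i : k) + 1 ≠ 0 := by exact_mod_cast i.succ_ne_zero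
    rw [LinearMap.comp_apply, integralX_monomial, map_smul, adY_apply, commutator_monomial_y,
      Nat.cast_add_one, inv_smul_smul₀ h]
    rfl
  exact LinearMap.congr_fun this a

/-- Elements which commute with both generators have vanishing derivatives in `x` and `y`, so they
are constants. -/
theorem eq_algebraMap_of_commute {a : W1 k} (hx : X * a = a * X) (hy : Y * a = a * Y) :
    ∃ r : k, a = algebraMap k (W1 k) r := by
  have hK := constY_of_adX_eq_zero (a := a) (by rw [adX_apply, hx, sub_self])
  have key : constY k ∘ₗ integralX k ∘ₗ adY k ∘ₗ constY k
      = constY k - (LinearMap.toSpanSingleton k (W1 k) 1).comp ((basis 1).coord (0, 0)) :=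
    linearMap_ext fun i j => by
      simp only [LinearMap.comp_apply, LinearMap.sub_apply, Module.Basis.coord_apply,
        basis_repr_monomial, constY_monomial, LinearMap.toSpanSingleton_apply]
      rcases Nat.eq_zero_or_pos j with rfl | hj
      · have h1 := commutator_monomial_y (k := k) i 0
        simp only [pow_zero, mul_one] at h1
        rw [if_pos rfl, adY_apply, h1, map_smul, map_smul]
        have h2 := integralX_monomial (k := k) (i - 1) 0
        simp only [pow_zero, mul_one] at h2
        rw [h2, map_smul]
        have h3 := constY_monomial (k := k) (i - 1 + 1) 0
        simp only [pow_zero, mul_one, if_true] at h3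
        rw [h3]
        cases i with
        | zero => simp
        | succ i =>
          have h : (i : k) + 1 ≠ 0 := by exact_mod_cast i.succ_ne_zero
          rw [Nat.cast_add_one, Nat.add_sub_cancel, smul_inv_smul₀ h]
          simp
      · simp [hj.ne']
  have h := LinearMap.congr_fun key a
  simp only [LinearMap.comp_apply, LinearMap.sub_apply, hK] at h
  rw [adY_apply, hy, sub_self, map_zero, map_zero] at h
  exact ⟨(basis 1).coord (0, 0) a, (sub_eq_zero.1 h.symm).trans
    ((LinearMap.toSpanSingleton_apply ..).trans (Algebra.algebraMap_eq_smul_one _).symm)⟩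

/-- All derivations of the Weyl algebra are inner: correcting by an inner derivation one may
assume `D x = 0`; then `D y` commutes with `x`, hence is a polynomial in `x`, and it is the
commutator with `y` of its antiderivative. -/
theorem exists_inner (D : W1 k →ₗ[k] W1 k) (hD : ∀ a b, D (a * b) = a * D b + D a * b) :
    ∃ m : W1 k, ∀ a, D a = a * m - m * a := by
  have h1 : D 1 = 0 := by simpa using hD 1 1
  set m := integralY k (D X) with hm
  have hx : X * m - m * X = D X := by rw [← adX_apply, hm, adX_integralY]
  set w := D Y - (Y * m - m * Y) with hw
  have hrel : X * Y - Y * X = 1 := by simpa using relation (R := k) (q := 1)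
  have hwx : adX k w = 0 := by
    have e := congrArg D hrel
    rw [map_sub, hD, hD, h1, ← hx] at e
    have e2 : X * w - w * X = X * D Y + (X * m - m * X) * Y - (Y * (X * m - m * X) + D Y * X)
        + m * (X * Y - Y * X) - (X * Y - Y * X) * m := by
      rw [hw]; noncomm_ring
    rw [adX_apply, e2, e, hrel]
    simp
  have hK := constY_of_adX_eq_zero hwx
  set p := integralX k w with hp
  have hpx : X * p - p * X = 0 := by
    have := adX_integralX_constY w
    rwa [hK, adX_apply] at this
  have hpy : p * Y - Y * p = w := by rw [← adY_apply, hp, adY_integralX]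
  refine ⟨m - p, fun a => ?_⟩
  induction a using induction with
  | scalar r =>
    rw [Algebra.algebraMap_eq_smul_one, map_smul, h1]
    simp
  | gen_x => rw [mul_sub, sub_mul, sub_sub_sub_comm, hx, hpx, sub_zero]
  | gen_y =>
    have : Y * (m - p) - (m - p) * Y = (Y * m - m * Y) + (p * Y - Y * p) := by noncomm_ring
    rw [this, hpy, hw]
    abel
  | mul a b ha hb => rw [hD, ha, hb]; noncomm_ring
  | add a b ha hb => rw [map_add, ha, hb]; noncomm_ring

end

end QWeyl

/-! ### Hochschild cochains with general coefficients -/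

theorem Fin.contractNth_castSucc_snoc {A : Type v} [Mul A] {n : ℕ} (j : Fin n) (a : Fin (n + 1) → A)
    (b : A) : Fin.contractNth j.castSucc.castSucc (· * ·) (Fin.snoc a b : Fin (n + 2) → A)
      = Fin.snoc (Fin.contractNth j.castSucc (· * ·) a) b := by
  ext i
  refine Fin.lastCases ?_ (fun i => ?_) i
  · rw [Fin.snoc_last, contractNth_apply_of_gt _ _ _ _ (by simp), Fin.succ_last, Fin.snoc_last]
  · rw [Fin.snoc_castSucc]
    rcases lt_trichotomy (i : ℕ) j with h | h | h
    · rw [contractNth_apply_of_lt _ _ _ _ (by simpa using h),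
        contractNth_apply_of_lt _ _ _ _ (by simpa using h), Fin.snoc_castSucc]
    · rw [contractNth_apply_of_eq _ _ _ _ (by simpa using h),
        contractNth_apply_of_eq _ _ _ _ (by simpa using h), ← Fin.castSucc_succ, Fin.snoc_castSucc,
        Fin.snoc_castSucc]
    · rw [contractNth_apply_of_gt _ _ _ _ (by simpa using h),
        contractNth_apply_of_gt _ _ _ _ (by simpa using h), ← Fin.castSucc_succ, Fin.snoc_castSucc]

theorem Fin.contractNth_last_snoc {A : Type v} [Mul A] {n : ℕ} (a : Fin (n + 1) → A) (b : A) :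
    Fin.contractNth (Fin.last n).castSucc (· * ·) (Fin.snoc a b : Fin (n + 2) → A)
      = Fin.snoc (fun i : Fin n => a i.castSucc) (a (Fin.last n) * b) := by
  ext i
  refine Fin.lastCases ?_ (fun i => ?_) i
  · rw [Fin.snoc_last, contractNth_apply_of_eq _ _ _ _ (by simp), Fin.succ_last, Fin.snoc_last,
      Fin.snoc_castSucc]
  · rw [contractNth_apply_of_lt _ _ _ _ (by simp), Fin.snoc_castSucc, Fin.snoc_castSucc]

theorem Function.update_pair_one {A : Type v} (a b c : A) :
    Function.update ![a, b] 1 c = ![a, c] := by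
  ext i; fin_cases i <;> rfl

/-- Coefficients for Hochschild cohomology: an `R`-module with commuting actions of `A` on the left
and on the right. The right action is not required to be unital, so that the construction
`HochschildCoeff.twist` applies without passing to normalized cochains. -/
structure HochschildCoeff (R : Type u) [CommRing R] (A : Type v) [Ring A] [Algebra R A]
    (M : Type w) [AddCommGroup M] [Module R M] where
  /-- The left action. -/
  l : A →ₐ[R] Module.End R M
  /-- The right action. -/
  r : A →ₗ[R] Module.End R M
  r_mul : ∀ a b m, r (a * b) m = r b (r a m)
  l_r : ∀ a b m, l a (r b m) = r b (l a m)

namespace HochschildCoeff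

variable {R : Type u} [CommRing R] {A : Type v} [Ring A] [Algebra R A]

section

variable {M : Type w} [AddCommGroup M] [Module R M] (B : HochschildCoeff R A M)

theorem l_mul (a b : A) (m : M) : B.l (a * b) m = B.l a (B.l b m) := by
  rw [map_mul, Module.End.mul_apply]

/-- The Hochschild coboundary of a cochain with coefficients in `M`. -/
def d {n : ℕ} (f : MultilinearMap R (fun _ : Fin n => A) M) (a : Fin (n + 1) → A) : M :=
  B.l (a 0) (f fun i => a i.succ)
    + ∑ j : Fin n, (-1 : ℤ) ^ ((j : ℕ) + 1) • f (Fin.contractNth j.castSucc (· * ·) a)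
    + (-1 : ℤ) ^ (n + 1) • B.r (a (Fin.last n)) (f fun i => a i.castSucc)

/-- The module of linear maps `A → M` with the actions `(a f)(b) = a f(b)` and
`(f a)(b) = f(a b) - f(a) b`. Currying the last argument identifies cochains of arity `n + 1` with
coefficients in `M` and cochains of arity `n` with coefficients in this module. -/
def twist : HochschildCoeff R A (A →ₗ[R] M) where
  l := AlgHom.ofLinearMap ((LinearMap.llcomp R A M M).comp B.l.toLinearMap)
    (LinearMap.ext fun f => LinearMap.ext fun b => by simp)
    (fun a b => LinearMap.ext fun f => LinearMap.ext fun c => by simp)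
  r := LinearMap.mk₂ R (fun a f => f ∘ₗ LinearMap.mulLeft R a - B.r.flip (f a))
      (fun a b f => LinearMap.ext fun c => by simp [add_mul]; abel)
      (fun s a f => LinearMap.ext fun c => by simp [smul_sub])
      (fun a f g => LinearMap.ext fun c => by simp; abel)
      (fun s a f => LinearMap.ext fun c => by simp [smul_sub])
  r_mul a b f := LinearMap.ext fun c => by simp [B.r_mul]
  l_r a b f := LinearMap.ext fun c => by simp [B.l_r]

@[simp]
theorem twist_l_apply (a : A) (f : A →ₗ[R] M) (b : A) : B.twist.l a f b = B.l a (f b) := rfl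

@[simp]
theorem twist_r_apply (a : A) (f : A →ₗ[R] M) (b : A) :
    B.twist.r a f b = f (a * b) - B.r b (f a) := rfl

/-- Currying the last argument commutes with the coboundaries. -/
theorem d_snoc {n : ℕ} (f : MultilinearMap R (fun _ : Fin (n + 1) => A) M) (a : Fin (n + 1) → A)
    (b : A) : B.d f (Fin.snoc a b) = B.twist.d f.curryRight a b := by
  have h0 : (fun i : Fin (n + 1) => (Fin.snoc a b : Fin (n + 2) → A) i.succ)
      = Fin.snoc (fun i : Fin n => a i.succ) b := by
    ext i
    refine Fin.lastCases ?_ (fun i => ?_) i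
    · rw [Fin.succ_last, Fin.snoc_last, Fin.snoc_last]
    · rw [← Fin.castSucc_succ, Fin.snoc_castSucc, Fin.snoc_castSucc]
  have h1 : (Fin.snoc a b : Fin (n + 2) → A) 0 = a 0 := by
    rw [← Fin.castSucc_zero, Fin.snoc_castSucc]
  have h2 : (fun i : Fin (n + 1) => (Fin.snoc a b : Fin (n + 2) → A) i.castSucc) = a := by
    ext i
    rw [Fin.snoc_castSucc]
  have h3 : (Fin.snoc (fun i : Fin n => a i.castSucc) (a (Fin.last n)) : Fin (n + 1) → A) = a :=
    Fin.snoc_init_self a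
  simp only [d, h0, h1, h2, Fin.sum_univ_castSucc, LinearMap.add_apply, LinearMap.sum_apply,
    LinearMap.smul_apply, twist_l_apply, twist_r_apply, MultilinearMap.curryRight_apply,
    Fin.contractNth_castSucc_snoc, Fin.contractNth_last_snoc, Fin.snoc_last, h3, smul_sub,
    Fin.val_castSucc, Fin.val_last]
  rw [pow_succ _ (n + 1), mul_neg_one, neg_smul]
  abel

end

section LowDegree

variable {M : Type w} [AddCommGroup M] [Module R M] (B : HochschildCoeff R A M)

theorem d_ofSubsingleton (g : A →ₗ[R] M) (a b : A) :
    B.d (MultilinearMap.ofSubsingleton R A M (0 : Fin 1) g) ![a, b]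
      = B.l a (g b) - g (a * b) + B.r b (g a) := by
  simp [d, Fin.contractNth]
  abel

theorem d_two (f : MultilinearMap R (fun _ : Fin 2 => A) M) (a b c : A) :
    B.d f ![a, b, c]
      = B.l a (f ![b, c]) - f ![a * b, c] + f ![a, b * c] - B.r c (f ![a, b]) := by
  have h1 : (fun i : Fin 2 => ![a, b, c] i.succ) = ![b, c] := by ext i; fin_cases i <;> rfl
  have h2 : (fun i : Fin 2 => ![a, b, c] i.castSucc) = ![a, b] := by ext i; fin_cases i <;> rfl
  have h3 : Fin.contractNth (Fin.castSucc (0 : Fin 2)) (· * ·) ![a, b, c] = ![a * b, c] := by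
    ext i; fin_cases i <;> rfl
  have h4 : Fin.contractNth (Fin.castSucc (1 : Fin 2)) (· * ·) ![a, b, c] = ![a, b * c] := by
    ext i; fin_cases i <;> rfl
  rw [d, Fin.sum_univ_two, h1, h2, h3, h4]
  simp [show Fin.last 2 = (2 : Fin 3) from rfl]
  abel

/-- A multilinear map in two arguments as a bilinear map. -/
def bilin (f : MultilinearMap R (fun _ : Fin 2 => A) M) : A →ₗ[R] A →ₗ[R] M :=
  LinearMap.mk₂ R (fun a b => f ![a, b])
    (fun a b c => f.cons_add ![c] a b)
    (fun s a b => f.cons_smul ![b] s a)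
    (fun a b c => by
      have h := f.map_update_add ![a, 0] 1 b c
      simpa only [Function.update_pair_one] using h)
    (fun s a b => by
      have h := f.map_update_smul ![a, 0] 1 s b
      simpa only [Function.update_pair_one] using h)

end LowDegree
end HochschildCoeff

/-! ### Vanishing of the cohomology of the Weyl algebra -/

namespace HochschildCoeff

section

variable {R : Type u} [CommRing R] {M : Type w} [AddCommGroup M] [Module R M]
  (B : HochschildCoeff R (QWeyl R 1) M)

local notation "𝓐" => QWeyl R (1 : R)
local notation "X" => QWeyl.x R (1 : R)
local notation "Y" => QWeyl.y R (1 : R)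

/-- Every element of `M` is of the form `[x, v] - [y, u]`, up to an element killed by the right
action of `A`. For unital `M` this is the vanishing of the second cohomology of the Koszul complex
of the commuting operators `[x, ·]` and `[y, ·]`. -/
def KoszulSurjective : Prop :=
  ∀ w : M, ∃ u v : M, ∀ b : 𝓐,
    B.r b (B.l X v - B.r X v - (B.l Y u - B.r Y u) - w) = 0

/-- Functions on pairs of exponents with `v (i + 1, j) = x v (i, j) - w (x ^ i y ^ j)`. -/
def solveX (w : 𝓐 →ₗ[R] M) : ℕ → ℕ → M
  | 0, _ => 0
  | i + 1, j => B.l X (solveX w i j) - w (X ^ i * Y ^ j)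

/-- The algebra is free as a left module over the polynomials in `x`, so for every `w` the
equation `x v(c) - v(x c) = w(c)` has a solution. -/
theorem exists_solveX (w : 𝓐 →ₗ[R] M) :
    ∃ v : 𝓐 →ₗ[R] M, ∀ c, v (X * c) = B.l X (v c) - w c := by
  set v := (QWeyl.basis (1 : R)).constr R fun p => B.solveX w p.1 p.2
  have hv : ∀ i j : ℕ, v (X ^ i * Y ^ j) = B.solveX w i j := fun i j => by
    simpa only [QWeyl.basis_apply] using
      (QWeyl.basis (1 : R)).constr_basis R (fun p => B.solveX w p.1 p.2) (i, j)
  refine ⟨v, fun c => ?_⟩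
  have : v ∘ₗ LinearMap.mulLeft R X = B.l X ∘ₗ v - w := QWeyl.linearMap_ext fun i j => by
    rw [LinearMap.comp_apply, LinearMap.mulLeft_apply, ← mul_assoc, ← pow_succ', hv]
    rw [LinearMap.sub_apply, LinearMap.comp_apply, hv, solveX]
  exact LinearMap.congr_fun this c

/-- With `u = 0` and the `v` of `exists_solveX`, the error is `c ↦ v(x) c`, which the right action
of `twist` annihilates. -/
theorem koszulSurjective_twist : B.twist.KoszulSurjective := fun w => by
  obtain ⟨v, hv⟩ := B.exists_solveX w
  have h : B.twist.l X v - B.twist.r X v - (B.twist.l Y 0 - B.twist.r Y 0) - w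
      = B.r.flip (v X) := LinearMap.ext fun c => by
    simp only [map_zero, sub_zero, LinearMap.sub_apply, twist_l_apply, twist_r_apply, hv,
      LinearMap.flip_apply]
    abel
  refine ⟨0, v, fun b => ?_⟩
  rw [h]
  ext c
  rw [twist_r_apply, LinearMap.flip_apply, LinearMap.flip_apply, B.r_mul, sub_self]
  rfl

/-- The action on `A × M` which sends `a` to `(b, m) ↦ (a b, a m + g b)`. -/
def triangular (a : 𝓐) (g : 𝓐 →ₗ[R] M) : Module.End R (𝓐 × M) :=
  (LinearMap.mulLeft R a ∘ₗ LinearMap.fst R 𝓐 M).prod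
    (B.l a ∘ₗ LinearMap.snd R 𝓐 M + g ∘ₗ LinearMap.fst R 𝓐 M)

theorem triangular_apply (a : 𝓐) (g : 𝓐 →ₗ[R] M) (p : 𝓐 × M) :
    B.triangular a g p = (a * p.1, B.l a p.2 + g p.1) := rfl

variable {B}

/-- If `u` and `v` correct the failure of the relation `[x, y] = 1`, then the operators by which the
lifts of `x` and `y` act satisfy it. -/
theorem triangular_relation {f : 𝓐 →ₗ[R] 𝓐 →ₗ[R] M}
    (hf : ∀ a b c, B.l a (f b c) - f (a * b) c + f a (b * c) - B.r c (f a b) = 0) {u v : M}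
    (huv : ∀ b, B.r b (B.l X v - B.r X v - (B.l Y u - B.r Y u) - (f Y X - f X Y - f 1 1)) = 0) :
    (1 : R) • (B.triangular X (B.r.flip u + f X) * B.triangular Y (B.r.flip v + f Y))
      - B.triangular Y (B.r.flip v + f Y) * B.triangular X (B.r.flip u + f X) = 1 := by
  have hf1 : ∀ b, f 1 b = B.r b (f 1 1) := fun b => by
    have h := hf 1 1 b
    rw [map_one, Module.End.one_apply, one_mul, one_mul, sub_self, zero_add] at h
    exact sub_eq_zero.1 h
  have hfm : ∀ a b c, f a (b * c) = B.r c (f a b) + f (a * b) c - B.l a (f b c) := fun a b c => by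
    rw [← sub_eq_zero, ← hf a b c]; abel
  have hrel : X * Y - Y * X = 1 := by simpa using QWeyl.relation (R := R) (q := 1)
  refine LinearMap.ext fun p => ?_
  obtain ⟨b, m⟩ := p
  simp only [one_smul, LinearMap.sub_apply, Module.End.mul_apply, Module.End.one_apply,
    triangular_apply, LinearMap.add_apply, LinearMap.flip_apply, map_add, hfm, Prod.mk_sub_mk]
  refine Prod.ext ?_ ?_
  · rw [← mul_assoc, ← mul_assoc, ← sub_mul, hrel, one_mul]
  · have h1 : B.l X (B.l Y m) = B.l Y (B.l X m) + m := by
      rw [← l_mul, ← l_mul, ← sub_eq_iff_eq_add', ← LinearMap.sub_apply, ← map_sub, hrel, map_one]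
      rfl
    have h2 : f (X * Y) b = f (Y * X) b + B.r b (f 1 1) := by
      rw [← hf1, ← sub_eq_iff_eq_add', ← LinearMap.sub_apply, ← map_sub, hrel]
    have h3 := huv b
    simp only [map_sub, ← B.l_r] at h3
    simp only [h1, h2, B.r_mul]
    rw [← sub_eq_zero, ← h3]
    abel

/-- A bilinear two-cocycle `f` is a coboundary up to an error killed by the right action. Namely
`f` defines an extension of `A` by `M`, in which the relation `[x, y] = 1` holds for suitable lifts
of `x` and `y`; the lifts act on `A × M`, so `A` does, and comparing with the given extension
yields the cochain `g`. -/
theorem exists_primitive_mul (hB : B.KoszulSurjective) {f : 𝓐 →ₗ[R] 𝓐 →ₗ[R] M}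
    (hf : ∀ a b c, B.l a (f b c) - f (a * b) c + f a (b * c) - B.r c (f a b) = 0) :
    ∃ g : 𝓐 →ₗ[R] M, ∀ a b c,
      B.r c (f a b) = B.r c (B.l a (g b) - g (a * b) + B.r b (g a)) := by
  obtain ⟨u, v, huv⟩ := hB (f Y X - f X Y - f 1 1)
  have hf1 : ∀ b, f 1 b = B.r b (f 1 1) := fun b => by
    have h := hf 1 1 b
    rw [map_one, Module.End.one_apply, one_mul, one_mul, sub_self, zero_add] at h
    exact sub_eq_zero.1 h
  obtain ⟨ρ, hρX, hρY⟩ : ∃ ρ : 𝓐 →ₐ[R] Module.End R (𝓐 × M),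
      ρ X = B.triangular X (B.r.flip u + f X) ∧ ρ Y = B.triangular Y (B.r.flip v + f Y) :=
    ⟨QWeyl.lift _ _ (triangular_relation hf huv), QWeyl.lift_x _, QWeyl.lift_y _⟩
  let G : 𝓐 →ₗ[R] 𝓐 →ₗ[R] M :=
    LinearMap.mk₂ R (fun a b => (ρ a (b, 0)).2)
      (fun a b c => by rw [map_add, LinearMap.add_apply, Prod.snd_add])
      (fun s a b => by rw [map_smul, LinearMap.smul_apply, Prod.smul_snd])
      (fun a b c => by rw [← Prod.snd_add, ← map_add, Prod.mk_add_mk, add_zero])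
      (fun s a b => by rw [← Prod.smul_snd, ← map_smul, Prod.smul_mk, smul_zero])
  have hG : ∀ a b, G a b = (ρ a (b, 0)).2 := fun _ _ => rfl
  -- An action of `a` of the form `(b, m) ↦ (a b, a m + g b)` has `g = G a`.
  have aux : ∀ (a : 𝓐) (g : 𝓐 → M), (∀ p, ρ a p = (a * p.1, B.l a p.2 + g p.1)) →
      ∀ p, ρ a p = (a * p.1, B.l a p.2 + G a p.1) := fun a g h p => by
    simp only [hG, h, map_zero, zero_add]
  have hρ : ∀ a p, ρ a p = (a * p.1, B.l a p.2 + G a p.1) := fun a => by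
    induction a using QWeyl.induction with
    | scalar s =>
      exact aux _ 0 fun p => by
        rw [AlgHom.commutes, AlgHom.commutes, Module.algebraMap_end_apply,
          Module.algebraMap_end_apply, Pi.zero_apply, add_zero, ← Algebra.smul_def]
        rfl
    | gen_x => exact aux _ (B.r.flip u + f X) fun p => by rw [hρX]; rfl
    | gen_y => exact aux _ (B.r.flip v + f Y) fun p => by rw [hρY]; rfl
    | mul a b ha hb =>
      exact aux _ (fun c => B.l a (G b c) + G a (b * c)) fun p => by
        rw [map_mul, Module.End.mul_apply, hb, ha, mul_assoc, l_mul, map_add, add_assoc]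
    | add a b ha hb =>
      exact aux _ (fun c => G a c + G b c) fun p => by
        rw [map_add, LinearMap.add_apply, hb, ha, map_add, LinearMap.add_apply, add_mul,
          Prod.mk_add_mk, add_add_add_comm]
  have hGgen : ∀ (a : 𝓐) (g : 𝓐 →ₗ[R] M), ρ a = B.triangular a g → ∀ c, G a c = g c :=
    fun a g h c => by rw [hG, h, triangular_apply, map_zero, zero_add]
  have hGmul : ∀ a b c, G (a * b) c = B.l a (G b c) + G a (b * c) := fun a b c => by
    rw [hG, map_mul, Module.End.mul_apply, hρ b, hρ a, map_zero, zero_add]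
  have hHmul : ∀ a b c, (G - f) (a * b) c
      = B.l a ((G - f) b c) + (G - f) a (b * c) + B.r c (f a b) := fun a b c => by
    simp only [LinearMap.sub_apply, hGmul, map_sub]
    rw [← sub_eq_zero, ← hf a b c]
    abel
  have hex : ∀ a, ∃ m, ∀ c, (G - f) a c = B.r c m := fun a => by
    induction a using QWeyl.induction with
    | scalar s =>
      refine ⟨-(s • f 1 1), fun c => ?_⟩
      rw [LinearMap.sub_apply, LinearMap.sub_apply, hG, AlgHom.commutes,
        Module.algebraMap_end_apply, Algebra.algebraMap_eq_smul_one, map_smul, LinearMap.smul_apply,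
        hf1, map_neg, map_smul, Prod.smul_snd, smul_zero, zero_sub]
    | gen_x => exact ⟨u, fun c => by
        rw [LinearMap.sub_apply, LinearMap.sub_apply, hGgen _ _ hρX]; simp⟩
    | gen_y => exact ⟨v, fun c => by
        rw [LinearMap.sub_apply, LinearMap.sub_apply, hGgen _ _ hρY]; simp⟩
    | mul a b ha hb =>
      obtain ⟨m, hm⟩ := ha
      obtain ⟨n, hn⟩ := hb
      exact ⟨B.l a n + B.r b m + f a b, fun c => by
        rw [hHmul, hm, hn, B.l_r, B.r_mul, map_add, map_add]⟩
    | add a b ha hb =>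
      obtain ⟨m, hm⟩ := ha
      obtain ⟨n, hn⟩ := hb
      exact ⟨m + n, fun c => by rw [map_add, LinearMap.add_apply, hm, hn, map_add]⟩
  have hH : ∀ a c, (G - f) a c = B.r c ((G - f) a 1) := fun a c => by
    obtain ⟨m, hm⟩ := hex a
    rw [hm, hm, ← B.r_mul, one_mul]
  refine ⟨-(G - f).flip 1, fun a b c => ?_⟩
  have h := hHmul a b c
  rw [hH (a * b), hH b, hH a (b * c), B.l_r, B.r_mul] at h
  simp only [LinearMap.neg_apply, LinearMap.flip_apply, map_neg, map_sub, map_add, h]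
  abel

/-- Under `KoszulSurjective`, two-cocycles are coboundaries. -/
theorem exists_primitive_two (hB : B.KoszulSurjective) {f : 𝓐 →ₗ[R] 𝓐 →ₗ[R] M}
    (hf : ∀ a b c, B.l a (f b c) - f (a * b) c + f a (b * c) - B.r c (f a b) = 0) :
    ∃ g : 𝓐 →ₗ[R] M, ∀ a b, f a b = B.l a (g b) - g (a * b) + B.r b (g a) := by
  obtain ⟨g, hg⟩ := exists_primitive_mul hB hf
  -- The error `e = f - δ g` satisfies `e(a, b) c = 0`, so the cocycle identity at `(a, b, 1)`
  -- exhibits `e` as the coboundary of `- e(·, 1)`.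
  let e : 𝓐 → 𝓐 → M := fun a b => f a b - (B.l a (g b) - g (a * b) + B.r b (g a))
  have he : ∀ a b c, B.r c (e a b) = 0 := fun a b c => by
    simp only [e, map_sub _ (f a b), hg, sub_self]
  have hcoc : ∀ a b, e a b = e (a * b) 1 - B.l a (e b 1) := fun a b => by
    have h1 := hf a b 1
    have h2 : B.r 1 (f a b) = _ := hg a b 1
    rw [h2] at h1
    simp only [mul_one] at h1
    rw [← sub_eq_zero, ← h1]
    have hr : B.r 1 (B.r b (g a)) = B.r b (g a) := by rw [← B.r_mul, mul_one]
    simp only [e, map_sub, map_add, l_mul, B.l_r, mul_one, hr]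
    abel
  obtain ⟨E, hE⟩ : ∃ E : 𝓐 →ₗ[R] M, ∀ a, E a = e a 1 :=
    ⟨f.flip 1 - (B.l.toLinearMap.flip (g 1) - g + B.r 1 ∘ₗ g), fun a => by
      simp only [e, mul_one]
      rfl⟩
  refine ⟨g - E, fun a b => ?_⟩
  have h : f a b - (B.l a (g b) - g (a * b) + B.r b (g a)) = E (a * b) - B.l a (E b) := by
    rw [hE, hE]
    exact hcoc a b
  have hr : B.r b (E a) = 0 := by rw [hE, he]
  rw [sub_eq_iff_eq_add] at h
  rw [h, LinearMap.sub_apply, LinearMap.sub_apply, LinearMap.sub_apply, map_sub, map_sub, hr]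
  abel

/-- Vanishing in degrees at least two, by shifting the degree down to two. -/
theorem exists_primitive {n : ℕ} {M : Type u} [AddCommGroup M] [Module R M]
    {B : HochschildCoeff R 𝓐 M} (hB : B.KoszulSurjective)
    (f : MultilinearMap R (fun _ : Fin (n + 2) => 𝓐) M) (hf : ∀ a, B.d f a = 0) :
    ∃ g : MultilinearMap R (fun _ : Fin (n + 1) => 𝓐) M, ∀ a, f a = B.d g a := by
  induction n generalizing M with
  | zero =>
    obtain ⟨g, hg⟩ := exists_primitive_two (f := bilin f) hB fun a b c => by
      rw [← hf ![a, b, c], d_two]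
      rfl
    refine ⟨MultilinearMap.ofSubsingleton R 𝓐 M (0 : Fin 1) g, fun a => ?_⟩
    have ha : a = ![a 0, a 1] := by ext i; fin_cases i <;> rfl
    rw [ha, d_ofSubsingleton, ← hg]
    rfl
  | succ n ih =>
    obtain ⟨g, hg⟩ := ih B.koszulSurjective_twist f.curryRight fun a => LinearMap.ext fun b => by
      rw [← d_snoc, hf]
      rfl
    refine ⟨g.uncurryRight, fun a => ?_⟩
    rw [← Fin.snoc_init_self a, ← MultilinearMap.curryRight_apply, hg, d_snoc,
      MultilinearMap.curry_uncurryRight]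

end

/-- The algebra as coefficients over itself. -/
def self (R : Type u) [CommRing R] (A : Type v) [Ring A] [Algebra R A] : HochschildCoeff R A A where
  l := Algebra.lmul R A
  r := (LinearMap.mul R A).flip
  r_mul a b m := (mul_assoc m a b).symm
  l_r a b m := (mul_assoc a m b).symm

theorem self_d {R : Type u} [CommRing R] {A : Type v} [Ring A] [Algebra R A] {n : ℕ}
    (f : HochschildCochain R A n) (a : Fin (n + 1) → A) :
    (self R A).d f.toMultilinearMap a = hochschildD f a := by
  have e : ∀ (j : ℕ) (b : A), (-1 : ℤ) ^ j • b = (-1 : A) ^ j * b := fun j b => by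
    rw [zsmul_eq_mul]
    push_cast
    rfl
  simp only [d, hochschildD, e]
  rfl

theorem koszulSurjective_self {k : Type u} [Field k] [CharZero k] :
    (self k (W1 k)).KoszulSurjective := fun w =>
  ⟨0, QWeyl.integralY k w, fun b => by
    have h : (self k (W1 k)).l (QWeyl.x k 1) (QWeyl.integralY k w)
      - (self k (W1 k)).r (QWeyl.x k 1) (QWeyl.integralY k w) = w := QWeyl.adX_integralY w
    rw [h, map_zero, map_zero, sub_self, sub_zero, sub_self, map_zero]⟩

end HochschildCoeff

theorem hochschildCohomology_subsingleton_iff {R : Type u} [CommRing R] {A : Type v} [Ring A]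
    [Algebra R A] {n : ℕ} : Subsingleton (HochschildCohomology R A (n + 1)) ↔
      ∀ f : HochschildCochain R A (n + 1), (∀ a, hochschildD f a = 0) →
        ∃ g : HochschildCochain R A n, ∀ a, f a = hochschildD g a := by
  rw [Submodule.Quotient.subsingleton_iff, Submodule.submoduleOf, Submodule.eq_top_iff']
  exact ⟨fun h f hf => h ⟨f, hf⟩, fun h f => h f.1 f.2⟩

/-- Cocycles of the Weyl algebra of positive degree are coboundaries: in degree one they are
derivations, in higher degrees `HochschildCoeff.exists_primitive` applies. -/
theorem W1.exists_primitive {k : Type u} [Field k] [CharZero k] {n : ℕ}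
    (f : HochschildCochain k (W1 k) (n + 1)) (hf : ∀ a, hochschildD f a = 0) :
    ∃ g : HochschildCochain k (W1 k) n, ∀ a, f a = hochschildD g a := by
  cases n with
  | zero =>
    obtain ⟨D, hD⟩ := (MultilinearMap.ofSubsingleton k (W1 k) (W1 k) (0 : Fin 1)).surjective
      f.toMultilinearMap
    obtain ⟨m, hm⟩ := QWeyl.exists_inner D fun a b => by
      have h := HochschildCoeff.self_d f ![a, b]
      rw [hf, ← hD, HochschildCoeff.d_ofSubsingleton] at h
      change a * D b - D (a * b) + D a * b = 0 at h
      rw [← sub_eq_zero, ← neg_eq_zero, ← h]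
      abel
    refine ⟨HochschildCochain.const k (W1 k) m, fun a => ?_⟩
    have h : f a = a 0 * m - m * a 0 := by
      rw [← hm]
      exact (DFunLike.congr_fun hD a).symm
    rw [h]
    simp [hochschildD, HochschildCochain.const_apply, sub_eq_add_neg]
  | succ n =>
    obtain ⟨g, hg⟩ := HochschildCoeff.exists_primitive HochschildCoeff.koszulSurjective_self
      f.toMultilinearMap fun a => by rw [HochschildCoeff.self_d, hf]
    exact ⟨g, fun a => (hg a).trans (HochschildCoeff.self_d g a)⟩

/-! ### Cohomology of formal power series over the Weyl algebra -/

namespace HochschildCoeff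

variable {R : Type u} [CommRing R] {A : Type v} [Ring A] [Algebra R A]

/-- The Hochschild coboundary of a cochain is multilinear. By `d_snoc`, linearity in the last
argument is automatic, and linearity in the others follows by induction on the arity. -/
theorem exists_multilinear_eq_d {n : ℕ} {M : Type v} [AddCommGroup M] [Module R M]
    (B : HochschildCoeff R A M) (f : MultilinearMap R (fun _ : Fin n => A) M) :
    ∃ D : MultilinearMap R (fun _ : Fin (n + 1) => A) M, ∀ a, D a = B.d f a := by
  induction n generalizing M with
  | zero =>
    refine ⟨MultilinearMap.ofSubsingleton R A M (0 : Fin 1)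
      (B.l.toLinearMap.flip (f ![]) - B.r.flip (f ![])), fun a => ?_⟩
    have e : ∀ b : Fin 0 → A, f b = f ![] := fun b => congrArg f (Subsingleton.elim _ _)
    simp [d, e, sub_eq_add_neg]
  | succ n ih =>
    obtain ⟨D, hD⟩ := ih B.twist f.curryRight
    refine ⟨D.uncurryRight, fun a => ?_⟩
    rw [MultilinearMap.uncurryRight_apply, hD, ← d_snoc, Fin.snoc_init_self]

end HochschildCoeff

theorem exists_multilinear_eq_hochschildD {R : Type u} [CommRing R] {A : Type v} [Ring A]
    [Algebra R A] {n : ℕ} (f : HochschildCochain R A n) :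
    ∃ D : HochschildCochain R A (n + 1), ∀ a, D a = hochschildD f a := by
  obtain ⟨D, hD⟩ := (HochschildCoeff.self R A).exists_multilinear_eq_d f.toMultilinearMap
  exact ⟨D, fun a => (hD a).trans (HochschildCoeff.self_d f a)⟩

namespace QWeyl

open PowerSeries

variable {R : Type u} [CommRing R] {q : R} {n : ℕ}

local notation "W" => QWeyl R q

theorem coeff_smul_powerSeries (c : PowerSeries R) (f : PowerSeries W) (s : ℕ) :
    coeff s (c • f) = ∑ p ∈ Finset.HasAntidiagonal.antidiagonal s, coeff p.1 c • coeff p.2 f := by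
  rw [Algebra.smul_def, coeff_mul]
  refine Finset.sum_congr rfl fun p _ => ?_
  rw [Algebra.smul_def]
  exact congrArg (· * _) (coeff_map (algebraMap R W) p.1 c)

theorem C_smul_powerSeries (c : R) (b : W) :
    (C (c • b) : PowerSeries W) = (C c : PowerSeries R) • C b := by
  rw [Algebra.smul_def, Algebra.smul_def, map_mul]
  congr 1
  exact (map_C (algebraMap R W) c).symm

theorem X_smul_powerSeries (f : PowerSeries W) : (X : PowerSeries R) • f = X * f := by
  rw [Algebra.smul_def]
  congr 1
  exact map_X (algebraMap R W)

/-- Cochains on power series are determined by their values on constant series: writing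
`b i = b i (0) + ħ c`, the coefficient of `ħ ^ s` in the value is expressed through lower ones. -/
theorem eq_zero_of_constants (f : HochschildCochain (PowerSeries R) (PowerSeries W) n)
    (hf : ∀ w : Fin n → W, f (fun i => C (w i)) = 0) (b : Fin n → PowerSeries W) : f b = 0 := by
  classical
  suffices h : ∀ s : ℕ, ∀ b : Fin n → PowerSeries W, coeff s (f b) = 0 by
    ext s
    rw [h, map_zero]
  intro s
  induction s using Nat.strong_induction_on with
  | _ s ih =>
  intro b
  have key : ∀ t : Finset (Fin n),
      coeff s (f (t.piecewise b fun i => C (constantCoeff (b i)))) = 0 := by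
    intro t
    induction t using Finset.induction_on with
    | empty => rw [Finset.piecewise_empty, hf, map_zero]
    | insert i t hi iht =>
      have e : b i = C (constantCoeff (b i))
          + (X : PowerSeries R) • PowerSeries.mk fun p => coeff (p + 1) (b i) := by
        rw [X_smul_powerSeries, add_comm]
        exact eq_X_mul_shift_add_const (b i)
      have e2 : Function.update (t.piecewise b fun i => C (constantCoeff (b i))) i
          (C (constantCoeff (b i))) = t.piecewise b fun i => C (constantCoeff (b i)) := by
        rw [Function.update_eq_self_iff, Finset.piecewise_eq_of_notMem _ _ _ hi]
      rw [Finset.piecewise_insert, e, HochschildCochain.map_update_add,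
        HochschildCochain.map_update_smul, e2, map_add, iht, zero_add, X_smul_powerSeries]
      cases s with
      | zero => exact coeff_zero_X_mul _
      | succ s => rw [coeff_succ_X_mul, ih s s.lt_succ_self]
  simpa using key Finset.univ

/-- The coefficient of `ħ ^ s` in the restriction of a cochain to constant series. -/
def coeffCochain (f : HochschildCochain (PowerSeries R) (PowerSeries W) n) (s : ℕ) :
    HochschildCochain R W n :=
  MultilinearMap.mk' (fun w => coeff s (f fun i => C (w i)))
    (fun w i a b => by
      have e : ∀ c, (fun j => (C (Function.update w i c j) : PowerSeries W))
          = Function.update (fun j => C (w j)) i (C c) := fun c => Function.comp_update C w i c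
      rw [e, e, e, map_add, f.map_update_add, map_add])
    (fun w i r a => by
      have e : ∀ c, (fun j => (C (Function.update w i c j) : PowerSeries W))
          = Function.update (fun j => C (w j)) i (C c) := fun c => Function.comp_update C w i c
      rw [e, e, C_smul_powerSeries, f.map_update_smul, coeff_smul_powerSeries,
        Finset.sum_eq_single (0, s)]
      · simp
      · rintro ⟨a, b⟩ h h2
        rw [coeff_C, if_neg, zero_smul]
        rintro rfl
        simp at h
        exact h2 (by rw [h])
      · simp)

theorem coeffCochain_apply (f : HochschildCochain (PowerSeries R) (PowerSeries W) n) (s : ℕ)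
    (w : Fin n → W) : coeffCochain f s w = coeff s (f fun i => C (w i)) := rfl

theorem hochschildD_coeffCochain (f : HochschildCochain (PowerSeries R) (PowerSeries W) n) (s : ℕ)
    (w : Fin (n + 1) → W) :
    hochschildD (coeffCochain f s) w = coeff s (hochschildD f fun i => C (w i)) := by
  have e : ∀ j : ℕ, ((-1) ^ j : PowerSeries W) = C ((-1) ^ j) := fun j => by simp
  simp only [hochschildD, coeffCochain_apply, map_add, map_sum, e, coeff_C_mul, coeff_mul_C]
  congr 2
  refine Finset.sum_congr rfl fun j _ => ?_
  congr 4
  exact (Fin.comp_contractNth (f := C) (· * ·) (· * ·) (fun a b => map_mul C a b) _ w)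

/-- The coefficients of the extension to power series of a series of cochains `∑ ħ ^ r g_r`: the
coefficient of `ħ ^ s` is the sum of `g_{p 0}(b_{p 1}, …, b_{p n})` over the exponents with
`p 0 + p 1 + ⋯ + p n = s`. -/
def extendCoeff (g : ℕ → HochschildCochain R W n) (b : Fin n → PowerSeries W) (s : ℕ) : W :=
  ∑ p ∈ Finset.piAntidiag (Finset.univ : Finset (Fin (n + 1))) s,
    g (p 0) fun i => coeff (p i.succ) (b i)

/-- As a function of one argument `extendCoeff` is a convolution with linear maps. -/
theorem extendCoeff_update (g : ℕ → HochschildCochain R W n) (b : Fin n → PowerSeries W)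
    (j : Fin n) : ∃ H : ℕ → W →ₗ[R] W, ∀ (c : PowerSeries W) (s : ℕ),
      extendCoeff g (Function.update b j c) s
        = ∑ p ∈ Finset.HasAntidiagonal.antidiagonal s, H p.2 (coeff p.1 c) := by
  classical
  refine ⟨fun m => ∑ p ∈ Finset.piAntidiag (Finset.univ.erase j.succ) m,
    (g (p 0)).toMultilinearMap.toLinearMap (fun i => coeff (p i.succ) (b i)) j, fun c s => ?_⟩
  have hu : (Finset.univ : Finset (Fin (n + 1)))
      = Finset.cons j.succ (Finset.univ.erase j.succ) (by simp) := by simp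
  rw [extendCoeff, hu, Finset.piAntidiag_cons, Finset.sum_disjiUnion]
  refine Finset.sum_congr rfl fun p _ => ?_
  rw [Finset.sum_map, LinearMap.sum_apply]
  refine Finset.sum_congr (by simp) fun r hr => ?_
  have hrj : r j.succ = 0 := by
    by_contra h
    simpa using (Finset.mem_piAntidiag.1 hr).2 _ h
  have h0 : (0 : Fin (n + 1)) ≠ j.succ := (Fin.succ_ne_zero j).symm
  simp only [addRightEmbedding_apply, Pi.add_apply, if_neg h0, add_zero]
  refine congrArg (g (r 0)) (funext fun i => ?_)
  rcases eq_or_ne i j with rfl | hi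
  · simp [hrj]
  · simp [hi]

theorem extendCoeff_const (g : ℕ → HochschildCochain R W n) (w : Fin n → W) (s : ℕ) :
    extendCoeff g (fun i => C (w i)) s = g s w := by
  classical
  rw [extendCoeff, Finset.sum_eq_single (Pi.single 0 s)]
  · simp
  · intro p hp hne
    obtain ⟨i, hi⟩ : ∃ i : Fin n, p i.succ ≠ 0 := by
      by_contra! h
      refine hne (funext fun i => ?_)
      have h0 := (Finset.mem_piAntidiag.1 hp).1
      rw [Fin.sum_univ_succ, Finset.sum_eq_zero fun i _ => h i, add_zero] at h0
      refine Fin.cases ?_ (fun i => ?_) i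
      · rw [h0, Pi.single_eq_same]
      · rw [h, Pi.single_eq_of_ne (Fin.succ_ne_zero i)]
    exact MultilinearMap.map_coord_zero (g (p 0)).toMultilinearMap i (by rw [coeff_C, if_neg hi])
  · intro h
    exact absurd (Finset.mem_piAntidiag.2 ⟨by simp, by simp⟩) h

/-- A formal power series of cochains extends to a cochain on power series. -/
theorem exists_extension (g : ℕ → HochschildCochain R W n) :
    ∃ G : HochschildCochain (PowerSeries R) (PowerSeries W) n, ∀ s, coeffCochain G s = g s := by
  refine ⟨MultilinearMap.mk' (fun b => PowerSeries.mk (extendCoeff g b)) ?_ ?_, fun s => ?_⟩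
  · intro b j c d
    obtain ⟨H, hH⟩ := extendCoeff_update g b j
    ext s
    simp only [map_add, coeff_mk, hH, Finset.sum_add_distrib]
  · intro b j r c
    obtain ⟨H, hH⟩ := extendCoeff_update g b j
    ext s
    simp only [coeff_smul_powerSeries, coeff_mk, hH, map_sum, map_smul, Finset.smul_sum,
      Finset.sum_sigma']
    refine Finset.sum_nbij' (fun p => ⟨(p.2.1, p.2.2 + p.1.2), (p.2.2, p.1.2)⟩)
      (fun p => ⟨(p.1.1 + p.2.1, p.2.2), (p.1.1, p.2.1)⟩) ?_ ?_ ?_ ?_ ?_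
    · rintro ⟨⟨a, b⟩, c, d⟩; simp; omega
    · rintro ⟨⟨a, b⟩, c, d⟩; simp; omega
    · rintro ⟨⟨a, b⟩, c, d⟩; simp
    · rintro ⟨⟨a, b⟩, c, d⟩; simp
    · rintro ⟨⟨a, b⟩, c, d⟩; simp
  · refine DFunLike.ext _ _ fun w => ?_
    change coeff s (PowerSeries.mk (extendCoeff g fun i => C (w i))) = _
    rw [coeff_mk, extendCoeff_const]

/-- If all cocycles of the algebra are coboundaries, so are those of the formal power series over
it: one argues coefficient by coefficient. -/
theorem exists_primitive_powerSeries
    (h : ∀ f : HochschildCochain R W (n + 1), (∀ a, hochschildD f a = 0) →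
      ∃ g : HochschildCochain R W n, ∀ a, f a = hochschildD g a)
    (f : HochschildCochain (PowerSeries R) (PowerSeries W) (n + 1))
    (hf : ∀ a, hochschildD f a = 0) :
    ∃ g : HochschildCochain (PowerSeries R) (PowerSeries W) n, ∀ a, f a = hochschildD g a := by
  choose g hg using fun s => h (coeffCochain f s) fun a => by
    rw [hochschildD_coeffCochain, hf, map_zero]
  obtain ⟨G, hG⟩ := exists_extension g
  obtain ⟨D, hD⟩ := exists_multilinear_eq_hochschildD G
  refine ⟨G, fun a => ?_⟩
  have hz := eq_zero_of_constants (f - D) (fun w => ?_) a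
  · rw [← hD, ← sub_eq_zero]
    exact hz
  · change f _ - D _ = 0
    ext s
    rw [map_sub, hD, ← hochschildD_coeffCochain, hG, ← hg, coeffCochain_apply, sub_self, map_zero]

end QWeyl

section Transport

variable {R : Type u} [CommRing R] {A : Type v} [Ring A] [Algebra R A] {B : Type w} [Ring B]
  [Algebra R B] {n : ℕ}

/-- The cochain on `A` which corresponds to a cochain on `B` under an isomorphism `A ≃ B`. -/
def HochschildCochain.transport (e : A ≃ₐ[R] B) (f : HochschildCochain R B n) :
    HochschildCochain R A n :=
  e.symm.toLinearMap.compMultilinearMap (f.toMultilinearMap.compLinearMap fun _ => e.toLinearMap)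

theorem HochschildCochain.transport_apply (e : A ≃ₐ[R] B) (f : HochschildCochain R B n)
    (a : Fin n → A) : f.transport e a = e.symm (f (e ∘ a)) := rfl

theorem hochschildD_transport (e : A ≃ₐ[R] B) (f : HochschildCochain R B n) (a : Fin (n + 1) → A) :
    hochschildD (f.transport e) a = e.symm (hochschildD f (e ∘ a)) := by
  simp only [hochschildD, HochschildCochain.transport_apply, map_add, map_sum, map_mul, map_pow,
    map_neg, map_one, Function.comp_apply, AlgEquiv.symm_apply_apply,
    Fin.comp_contractNth (f := e) (· * ·) (· * ·) (fun a b => map_mul e a b)]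
  rfl

/-- The vanishing of Hochschild cohomology is invariant under isomorphisms of algebras. -/
theorem AlgEquiv.hochschild_exists_primitive (e : A ≃ₐ[R] B)
    (h : ∀ f : HochschildCochain R A (n + 1), (∀ a, hochschildD f a = 0) →
      ∃ g : HochschildCochain R A n, ∀ a, f a = hochschildD g a)
    (f : HochschildCochain R B (n + 1)) (hf : ∀ a, hochschildD f a = 0) :
    ∃ g : HochschildCochain R B n, ∀ a, f a = hochschildD g a := by
  obtain ⟨g, hg⟩ := h (f.transport e) fun a => by rw [hochschildD_transport, hf, map_zero]
  refine ⟨g.transport e.symm, fun a => ?_⟩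
  rw [hochschildD_transport, ← hg, HochschildCochain.transport_apply, AlgEquiv.symm_symm,
    AlgEquiv.apply_symm_apply]
  exact congrArg f (funext fun i => (e.apply_symm_apply (a i)).symm)

end Transport

/-! ### Adic completions of torsion-free algebras -/

section Completion

variable {R : Type u} [CommRing R] {t : R} {A : Type v} [Ring A] [Algebra R A]

namespace AdicAlgebra

theorem ext_val {a b : AdicAlgebra t A} (h : ∀ n, a.1 n = b.1 n) : a = b :=
  Subtype.ext (funext h)

theorem add_val (a b : AdicAlgebra t A) (n : ℕ) : (a + b).1 n = a.1 n + b.1 n := rfl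

theorem sub_val (a b : AdicAlgebra t A) (n : ℕ) : (a - b).1 n = a.1 n - b.1 n := rfl

theorem mul_val (a b : AdicAlgebra t A) (n : ℕ) : (a * b).1 n = a.1 n * b.1 n := rfl

theorem one_val (n : ℕ) : (1 : AdicAlgebra t A).1 n = 1 := rfl

theorem zero_val (n : ℕ) : (0 : AdicAlgebra t A).1 n = 0 := rfl

theorem sum_val {ι : Type w} (s : Finset ι) (F : ι → AdicAlgebra t A) (n : ℕ) :
    (∑ i ∈ s, F i).1 n = ∑ i ∈ s, (F i).1 n := by
  rw [AddSubmonoidClass.coe_finsetSum, Finset.sum_apply]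

instance : Subsingleton (A ⧸ adicIdeal t A 0) :=
  Ideal.Quotient.subsingleton_iff.2 <| Ideal.eq_top_of_isUnit_mem _ (x := 1) ⟨1, by simp⟩ isUnit_one

theorem smul_val (r : R) (a : AdicAlgebra t A) (n : ℕ) : (r • a).1 n = r • a.1 n := rfl

theorem of_val (a : A) (n : ℕ) : (of t a).1 n = Ideal.Quotient.mk (adicIdeal t A n) a := rfl

theorem mk_smul (r : R) (a : A) (n : ℕ) :
    Ideal.Quotient.mk (adicIdeal t A n) (r • a) = r • Ideal.Quotient.mk (adicIdeal t A n) a := rfl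

theorem mk_eq_zero {n : ℕ} {a : A} :
    Ideal.Quotient.mk (adicIdeal t A n) a = 0 ↔ ∃ b : A, a = t ^ n • b :=
  Ideal.Quotient.eq_zero_iff_mem

theorem pow_smul_quotient {n m : ℕ} (h : n ≤ m) (z : A ⧸ adicIdeal t A n) : t ^ m • z = 0 := by
  obtain ⟨a, rfl⟩ := Ideal.Quotient.mk_surjective z
  rw [← mk_smul, mk_eq_zero]
  exact ⟨t ^ (m - n) • a, by rw [smul_smul, ← pow_add, Nat.add_sub_cancel' h]⟩

theorem val_factor (a : AdicAlgebra t A) {m n : ℕ} (h : m ≤ n) :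
    Ideal.Quotient.factor (adicIdeal_anti t A h) (a.1 n) = a.1 m := a.2 m n h

/-- Elements which are determined modulo `t ^ n` by representatives. -/
theorem exists_val_eq (s : ℕ → A)
    (hs : ∀ n, Ideal.Quotient.mk (adicIdeal t A n) (s (n + 1)) = Ideal.Quotient.mk _ (s n)) :
    ∃ z : AdicAlgebra t A, ∀ n, z.1 n = Ideal.Quotient.mk (adicIdeal t A n) (s n) := by
  refine ⟨⟨fun n => Ideal.Quotient.mk (adicIdeal t A n) (s n), fun m n h => ?_⟩, fun _ => rfl⟩
  rw [Ideal.Quotient.factor_mk]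
  induction n, h using Nat.le_induction with
  | base => rfl
  | succ n h ih =>
    rw [← ih, ← Ideal.Quotient.factor_mk (adicIdeal_anti t A h), hs, Ideal.Quotient.factor_mk]

theorem mk_sum_range {u : ℕ → A} (hu : ∀ r, ∃ b, u r = t ^ r • b) {n N : ℕ} (h : n ≤ N) :
    Ideal.Quotient.mk (adicIdeal t A n) (∑ r ∈ Finset.range N, u r)
      = Ideal.Quotient.mk _ (∑ r ∈ Finset.range n, u r) := by
  induction N, h using Nat.le_induction with
  | base => rfl
  | succ N h ih =>
    obtain ⟨b, hb⟩ := hu N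
    rw [Finset.sum_range_succ, map_add, ih, hb, mk_smul, pow_smul_quotient h, add_zero]

/-- A series whose `r`-th term is divisible by `t ^ r` converges. -/
theorem exists_sum {u : ℕ → A} (hu : ∀ r, ∃ b, u r = t ^ r • b) :
    ∃ z : AdicAlgebra t A, ∀ n,
      z.1 n = Ideal.Quotient.mk (adicIdeal t A n) (∑ r ∈ Finset.range n, u r) :=
  exists_val_eq _ fun n => mk_sum_range hu n.le_succ

theorem hasSum_of_val_eq {u : ℕ → A} (hu : ∀ r, ∃ b, u r = t ^ r • b) {z : AdicAlgebra t A}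
    (hz : ∀ n, z.1 n = Ideal.Quotient.mk (adicIdeal t A n) (∑ r ∈ Finset.range n, u r)) :
    HasSum u z := fun n =>
  (Filter.eventually_ge_atTop n).mono fun N hN => by rw [hz, mk_sum_range hu hN]

section TorsionFree

variable (htf : ∀ a : A, t • a = 0 → a = 0)

include htf

theorem mk_eq_zero_of_smul {n : ℕ} {a : A}
    (h : Ideal.Quotient.mk (adicIdeal t A (n + 1)) (t • a) = 0) :
    Ideal.Quotient.mk (adicIdeal t A n) a = 0 := by
  obtain ⟨b, hb⟩ := mk_eq_zero.1 h
  refine mk_eq_zero.2 ⟨b, ?_⟩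
  rw [← sub_eq_zero]
  apply htf
  rw [smul_sub, hb, smul_smul, pow_succ', sub_self]

theorem eq_zero_of_smul {a : AdicAlgebra t A} (h : t • a = 0) : a = 0 := ext_val fun n => by
  obtain ⟨b, hb⟩ := Ideal.Quotient.mk_surjective (a.1 (n + 1))
  rw [← val_factor a n.le_succ, ← hb, Ideal.Quotient.factor_mk]
  refine mk_eq_zero_of_smul htf ?_
  rw [mk_smul, hb, ← smul_val, h]
  rfl

/-- For torsion-free `A`, the elements of the completion which vanish modulo `t` are divisible by
`t`. -/
theorem exists_eq_smul {a : AdicAlgebra t A} (h : a.1 1 = 0) : ∃ b, a = t • b := by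
  have hex : ∀ n, ∃ c : A, a.1 (n + 1) = Ideal.Quotient.mk _ (t • c) := fun n => by
    obtain ⟨b, hb⟩ := Ideal.Quotient.mk_surjective (a.1 (n + 1))
    have h1 := val_factor a (Nat.le_add_left 1 n)
    rw [← hb, Ideal.Quotient.factor_mk, h] at h1
    obtain ⟨c, hc⟩ := mk_eq_zero.1 h1
    exact ⟨c, by rw [← hb, hc, pow_one]⟩
  choose c hc using hex
  obtain ⟨b, hb⟩ := exists_val_eq (t := t) c fun n => by
    rw [← sub_eq_zero, ← map_sub]
    refine mk_eq_zero_of_smul htf ?_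
    rw [smul_sub, map_sub, ← hc n, ← val_factor a (n + 1).le_succ, hc (n + 1),
      Ideal.Quotient.factor_mk, sub_self]
  refine ⟨b, ext_val fun n => ?_⟩
  rw [smul_val, hb, ← mk_smul, ← val_factor a n.le_succ, hc, Ideal.Quotient.factor_mk]

end TorsionFree

end AdicAlgebra

end Completion

/-! ### Formal power series and completions -/

section PowerSeries

open PowerSeries AdicAlgebra

variable {R : Type u} [CommRing R] {A : Type v} [Ring A] [Algebra (PowerSeries R) A]
  {B : Type w} [Ring B] (φ : B →+* AdicAlgebra (X : PowerSeries R) A)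

local notation "ħ" => (X : PowerSeries R)

/-- The reduction modulo `ħ ^ n` of the series `∑ ħ ^ r φ(f_r)`. -/
def evalMod (n : ℕ) (f : PowerSeries B) : A ⧸ adicIdeal ħ A n :=
  ∑ r ∈ Finset.range n, ħ ^ r • (φ (coeff r f)).1 n

theorem evalMod_add (n : ℕ) (f g : PowerSeries B) :
    evalMod φ n (f + g) = evalMod φ n f + evalMod φ n g := by
  simp only [evalMod, map_add, add_val, smul_add, Finset.sum_add_distrib]

theorem evalMod_mul (n : ℕ) (f g : PowerSeries B) :
    evalMod φ n (f * g) = evalMod φ n f * evalMod φ n g := by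
  simp only [evalMod, coeff_mul, map_sum, map_mul, sum_val, mul_val, Finset.smul_sum,
    Finset.Nat.sum_antidiagonal_eq_sum_range_succ_mk]
  have := Finset.sum_range_diag_flip n fun i j =>
    ħ ^ (i + j) • ((φ (coeff i f)).1 n * (φ (coeff j g)).1 n)
  rw [Finset.sum_mul_sum]
  calc _ = _ := Finset.sum_congr rfl fun m _ => Finset.sum_congr rfl fun i hi => by
        rw [Nat.add_sub_cancel' (Nat.lt_succ_iff.1 (Finset.mem_range.1 hi))]
    _ = _ := this
    _ = _ := Finset.sum_congr rfl fun i hi => by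
        rw [← Finset.sum_subset (Finset.range_mono (Nat.sub_le n i))]
        · refine Finset.sum_congr rfl fun j _ => ?_
          rw [smul_mul_smul_comm, pow_add]
        · intro j _ hj
          rw [smul_mul_smul_comm, ← pow_add, pow_smul_quotient]
          have := Finset.mem_range.1 hi
          rw [Finset.mem_range] at hj
          omega

theorem factor_evalMod {m n : ℕ} (h : m ≤ n) (f : PowerSeries B) :
    Ideal.Quotient.factor (adicIdeal_anti ħ A h) (evalMod φ n f) = evalMod φ m f := by
  have hs : ∀ (r : PowerSeries R) (z : A ⧸ adicIdeal ħ A n),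
      Ideal.Quotient.factor (adicIdeal_anti ħ A h) (r • z)
        = r • Ideal.Quotient.factor (adicIdeal_anti ħ A h) z := fun r z => by
    obtain ⟨a, rfl⟩ := Ideal.Quotient.mk_surjective z
    rfl
  rw [evalMod, map_sum, evalMod, ← Finset.sum_subset (Finset.range_mono h)]
  · exact Finset.sum_congr rfl fun r _ => by rw [hs, val_factor _ h]
  · intro r _ hr
    rw [hs, pow_smul_quotient (by simpa using hr)]

/-- The ring homomorphism `∑ ħ ^ r f_r ↦ ∑ ħ ^ r φ(f_r)` into an `ħ`-adic completion. -/
def evalSeries : PowerSeries B →+* AdicAlgebra ħ A where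
  toFun f := ⟨fun n => evalMod φ n f, fun _ _ h => factor_evalMod φ h f⟩
  map_one' := ext_val fun n => by
    change evalMod φ n 1 = 1
    cases n with
    | zero => exact Subsingleton.elim _ _
    | succ n =>
      rw [evalMod, Finset.sum_range_succ', Finset.sum_eq_zero]
      · simp [one_val]
      · intro r _
        simp [coeff_one, zero_val]
  map_mul' f g := ext_val fun n => evalMod_mul φ n f g
  map_zero' := ext_val fun n => by
    change evalMod φ n 0 = 0
    simp [evalMod, zero_val]
  map_add' f g := ext_val fun n => evalMod_add φ n f g

theorem evalSeries_val (f : PowerSeries B) (n : ℕ) :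
    (evalSeries φ f).1 n = ∑ r ∈ Finset.range n, ħ ^ r • (φ (coeff r f)).1 n := rfl

theorem evalSeries_C (b : B) : evalSeries φ (C b) = φ b := ext_val fun n => by
  cases n with
  | zero => exact Subsingleton.elim _ _
  | succ n =>
    rw [evalSeries_val, Finset.sum_range_succ', Finset.sum_eq_zero]
    · simp
    · intro r _
      simp [zero_val]

theorem evalSeries_X_mul (f : PowerSeries B) :
    evalSeries φ (X * f) = ħ • evalSeries φ f := ext_val fun n => by
  rw [smul_val]
  cases n with
  | zero => exact Subsingleton.elim _ _
  | succ n =>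
    have h : ħ • evalMod φ (n + 1) f
        = ∑ r ∈ Finset.range n, ħ ^ (r + 1) • (φ (coeff r f)).1 (n + 1) := by
      rw [evalMod, Finset.sum_range_succ, smul_add, smul_smul, ← pow_succ',
        pow_smul_quotient le_rfl, add_zero, Finset.smul_sum]
      exact Finset.sum_congr rfl fun r _ => by rw [smul_smul, ← pow_succ']
    change _ = ħ • evalMod φ (n + 1) f
    rw [h, evalSeries_val, Finset.sum_range_succ']
    simp [coeff_succ_X_mul, zero_val]

theorem evalSeries_eq_const_add (f : PowerSeries B) :
    evalSeries φ f
      = φ (coeff 0 f) + ħ • evalSeries φ (PowerSeries.mk fun r => coeff (r + 1) f) := by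
  rw [← evalSeries_X_mul, ← evalSeries_C φ, ← map_add, add_comm, coeff_zero_eq_constantCoeff]
  exact congrArg _ (eq_X_mul_shift_add_const f)

theorem evalSeries_injective (htf : ∀ a : A, ħ • a = 0 → a = 0)
    (hφ : ∀ b, (φ b).1 1 = 0 → b = 0) :
    Function.Injective (evalSeries φ) := by
  rw [injective_iff_map_eq_zero]
  suffices h : ∀ r, ∀ f : PowerSeries B, evalSeries φ f = 0 → coeff r f = 0 from
    fun f hf => PowerSeries.ext fun r => h r f hf
  have h0 : ∀ f : PowerSeries B, evalSeries φ f = 0 → coeff 0 f = 0 := fun f hf => hφ _ <| by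
    have := congrArg (fun z : AdicAlgebra ħ A => z.1 1) hf
    simpa [evalSeries_val, zero_val] using this
  intro r
  induction r with
  | zero => exact h0
  | succ r ih =>
    intro f hf
    have h := evalSeries_eq_const_add φ f
    rw [hf, h0 f hf, map_zero, zero_add] at h
    have h2 := AdicAlgebra.eq_zero_of_smul htf h.symm
    simpa using ih _ h2

/-- Successive approximation: `z = φ(b₀) + ħ z₁`, `z₁ = φ(b₁) + ħ z₂`, and so on. -/
theorem evalSeries_surjective (htf : ∀ a : A, ħ • a = 0 → a = 0)
    (hφ : ∀ z : AdicAlgebra ħ A, ∃ b, (φ b).1 1 = z.1 1) :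
    Function.Surjective (evalSeries φ) := by
  intro z
  have step : ∀ z : AdicAlgebra ħ A, ∃ (b : B) (z' : AdicAlgebra ħ A), z = φ b + ħ • z' :=
    fun z => by
      obtain ⟨b, hb⟩ := hφ z
      obtain ⟨z', hz'⟩ := exists_eq_smul htf (a := z - φ b) (by rw [sub_val, hb, sub_self])
      have h2 : z = φ b + ħ • z' := by rw [← hz', add_sub_cancel]
      exact ⟨b, z', h2⟩
  choose b nxt hb using step
  let s : ℕ → AdicAlgebra ħ A := fun r => nxt^[r] z
  have hs : ∀ r, s r = φ (b (s r)) + ħ • s (r + 1) := fun r => by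
    change _ = _ + ħ • nxt^[r + 1] z
    rw [Function.iterate_succ_apply']
    exact hb _
  have hsum : ∀ n, z = (∑ r ∈ Finset.range n, ħ ^ r • φ (b (s r))) + ħ ^ n • s n := fun n => by
    induction n with
    | zero => simp [s]
    | succ n ih =>
      rw [Finset.sum_range_succ, add_assoc, pow_succ, mul_smul, ← smul_add, ← hs, ← ih]
  refine ⟨PowerSeries.mk fun r => b (s r), ext_val fun n => ?_⟩
  conv_rhs => rw [hsum n]
  rw [add_val, smul_val, pow_smul_quotient le_rfl, add_zero, evalSeries_val, sum_val]
  simp [smul_val]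

end PowerSeries

/-! ### Coordinates in the `q`-Weyl algebra over formal power series -/

namespace QWeyl

theorem repr_ofCoeffs {R : Type u} [CommRing R] {q : R} (c : ℕ × ℕ →₀ R) :
    (basis q).repr (ofCoeffs q c) = c :=
  (basis q).repr.apply_symm_apply c

theorem ofCoeffs_repr {R : Type u} [CommRing R] {q : R} (a : QWeyl R q) :
    ofCoeffs q ((basis q).repr a) = a :=
  (basis q).repr.symm_apply_apply a

theorem algebraMap_injective {R : Type u} [CommRing R] {q : R} :
    Function.Injective (algebraMap R (QWeyl R q)) := fun r s h => by
  have e : ∀ t : R, algebraMap R (QWeyl R q) t = ofCoeffs q (Finsupp.single (0, 0) t) := fun t => by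
    simp [Algebra.algebraMap_eq_smul_one]
  rw [e, e] at h
  exact Finsupp.single_injective _ ((basis q).repr.symm.injective h)

open PowerSeries

variable {R : Type u} [CommRing R] {q : PowerSeries R}

theorem X_pow_dvd_repr {n : ℕ} {a b : QWeyl (PowerSeries R) q}
    (h : a = (X : PowerSeries R) ^ n • b) (p : ℕ × ℕ) :
    (X : PowerSeries R) ^ n ∣ (basis q).repr a p := by
  rw [h, map_smul, Finsupp.smul_apply, smul_eq_mul]
  exact dvd_mul_right _ _

theorem eq_zero_of_X_smul (a : QWeyl (PowerSeries R) q) (h : (X : PowerSeries R) • a = 0) :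
    a = 0 := by
  apply (basis q).repr.injective
  ext p : 1
  have h2 := congrArg (fun b => (basis q).repr b p) h
  simp only [map_smul, Finsupp.smul_apply, smul_eq_mul, map_zero, Finsupp.zero_apply] at h2
  rw [map_zero, Finsupp.zero_apply]
  ext n
  simpa using congrArg (coeff (n + 1)) h2

/-- The algebra is free over `k[[ħ]]`, hence `ħ`-adically separated. -/
theorem of_injective :
    Function.Injective (AdicAlgebra.of (X : PowerSeries R) (A := QWeyl (PowerSeries R) q)) := by
  rw [injective_iff_map_eq_zero]
  intro a ha
  apply (basis q).repr.injective
  ext p n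
  obtain ⟨b, hb⟩ := AdicAlgebra.mk_eq_zero.1
    (show Ideal.Quotient.mk (adicIdeal (X : PowerSeries R) _ (n + 1)) a = 0 by
      rw [← AdicAlgebra.of_val, ha, AdicAlgebra.zero_val])
  simpa using X_pow_dvd_iff.1 (X_pow_dvd_repr hb p) n n.lt_succ_self

end QWeyl

/-! ### The trivialization of the deformation -/

section Trivialization

open PowerSeries AdicAlgebra

/-- A pair of elements with commutator `1` in a `k[[ħ]]`-algebra defines a `k`-linear homomorphism
from the Weyl algebra; linearity is stated through `k → k[[ħ]]`. -/
theorem exists_hom_of_relation {k : Type u} [Field k] {T : Type v} [Ring T]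
    [Algebra (PowerSeries k) T] {s z : T} (h : s * z - z * s = 1) :
    ∃ φ : W1 k →+* T, φ (QWeyl.x k 1) = s ∧ φ (QWeyl.y k 1) = z ∧
      ∀ c, φ (algebraMap k (W1 k) c) = algebraMap (PowerSeries k) T (C c) := by
  let _ : Algebra k T := Algebra.compHom T (C : k →+* PowerSeries k)
  let φ : W1 k →ₐ[k] T := QWeyl.lift s z (by rw [one_smul, h])
  exact ⟨φ, QWeyl.lift_x _, QWeyl.lift_y _, φ.commutes⟩

theorem exists_sub_sum_eq {k : Type u} [CommRing k] (c : PowerSeries k) (n : ℕ) :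
    ∃ d, c - ∑ r ∈ Finset.range n, X ^ r * C (coeff r c) = X ^ n * d := by
  refine X_pow_dvd_iff.2 fun m hm => ?_
  rw [map_sub, map_sum, Finset.sum_eq_single m]
  · simp
  · intro r _ hr
    rw [coeff_X_pow_mul', coeff_C]
    split_ifs with h1 h2
    · omega
    · rfl
    · rfl
  · intro h
    exact absurd (Finset.mem_range.2 hm) h

/-- If `φ` is `k`-linear, then its extension to power series is `k[[ħ]]`-linear. -/
theorem evalSeries_map {k : Type u} [Field k] {A : Type v} [Ring A] [Algebra (PowerSeries k) A]
    {B : Type w} [Ring B] [Algebra k B] (φ : B →+* AdicAlgebra (X : PowerSeries k) A)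
    (hφ : ∀ c, φ (algebraMap k B c) = algebraMap (PowerSeries k) _ (C c)) (c : PowerSeries k) :
    evalSeries φ (map (algebraMap k B) c) = algebraMap (PowerSeries k) _ c := ext_val fun n => by
  obtain ⟨d, hd⟩ := exists_sub_sum_eq c n
  have e : ∀ s : PowerSeries k,
      (algebraMap (PowerSeries k) (AdicAlgebra (X : PowerSeries k) A) s).1 n
      = s • (1 : A ⧸ adicIdeal (X : PowerSeries k) A n) := fun s => by
    rw [Algebra.algebraMap_eq_smul_one]
    rfl
  rw [sub_eq_iff_eq_add] at hd
  rw [evalSeries_val, e]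
  conv_rhs => rw [hd, add_smul, mul_smul, pow_smul_quotient le_rfl, zero_add, Finset.sum_smul]
  refine Finset.sum_congr rfl fun r _ => ?_
  rw [coeff_map, hφ, e, smul_smul]

variable (k : Type u) [Field k]

local notation "ħ" => hbar k
local notation "xx" => xq k
local notation "yy" => yq k

/-- The coefficients `a_r = ħ ^ (r + 1) / ((1 + ħ) ^ (r + 1) - 1)`. -/
def trivCoeff (r : ℕ) : PowerSeries k := X ^ r * (QWeyl.qInt (1 + ħ) (r + 1))⁻¹

/-- The terms of the series for the image of `y` in the completed algebra. -/
def trivTerm (r : ℕ) : Wq k := trivCoeff k r • (xx ^ r * yy ^ (r + 1))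

theorem qInt_mul_hbar (n : ℕ) : QWeyl.qInt (1 + ħ) n * ħ = (1 + ħ) ^ n - 1 := by
  rw [QWeyl.qInt, ← geom_sum_mul, add_sub_cancel_left]

theorem trivTerm_dvd (r : ℕ) : ∃ b, trivTerm k r = ħ ^ r • b :=
  ⟨_, by rw [trivTerm, trivCoeff, mul_smul]⟩

theorem trivCoeff_zero : trivCoeff k 0 = 1 := by
  have h : QWeyl.qInt (1 + ħ) 1 = 1 := by simp [QWeyl.qInt]
  rw [trivCoeff, zero_add, h, pow_zero, one_mul]
  simp

theorem trivTerm_zero : trivTerm k 0 = yy := by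
  rw [trivTerm, trivCoeff_zero, one_smul, pow_zero, one_mul, zero_add, pow_one]

section CharZero

variable [CharZero k]

theorem trivCoeff_mul_qInt (r : ℕ) : trivCoeff k r * QWeyl.qInt (1 + ħ) (r + 1) = ħ ^ r := by
  rw [trivCoeff, mul_assoc, PowerSeries.inv_mul_cancel, mul_one]
  have : constantCoeff (QWeyl.qInt (1 + ħ) (r + 1)) = (r : k) + 1 := by
    simp [QWeyl.qInt]
  rw [this]
  exact_mod_cast r.succ_ne_zero

theorem trivCoeff_mul (r : ℕ) : trivCoeff k r * ((1 + ħ) ^ (r + 1) - 1) = ħ ^ (r + 1) := by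
  rw [← qInt_mul_hbar, ← mul_assoc, trivCoeff_mul_qInt, pow_succ]

/-- The commutators of `x` with the terms of the series telescope. -/
theorem commutator_trivTerm (r : ℕ) : xx * trivTerm k r - trivTerm k r * xx
    = ħ ^ r • (xx ^ r * yy ^ r) - ħ ^ (r + 1) • (xx ^ (r + 1) * yy ^ (r + 1)) := by
  rw [← trivCoeff_mul, ← trivCoeff_mul_qInt, mul_smul, mul_smul, ← smul_sub, trivTerm,
    mul_smul_comm, smul_mul_assoc, ← smul_sub, mul_assoc _ _ (xq k), QWeyl.y_pow_mul_x, mul_sub,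
    mul_smul_comm, mul_smul_comm, Nat.add_sub_cancel, sub_smul, one_smul, ← mul_assoc, ← mul_assoc,
    ← pow_succ', ← pow_succ]
  congr 1
  abel

theorem commutator_of_val_eq {z : WqHat k}
    (hz : ∀ n, z.1 n = Ideal.Quotient.mk _ (∑ r ∈ Finset.range n, trivTerm k r)) :
    of ħ xx * z - z * of ħ xx = 1 := ext_val fun n => by
  rw [sub_val, mul_val, mul_val, of_val, hz, ← map_mul, ← map_mul, ← map_sub, Finset.mul_sum,
    Finset.sum_mul, ← Finset.sum_sub_distrib]
  simp only [commutator_trivTerm]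
  rw [Finset.sum_range_sub', map_sub, mk_smul (ħ ^ n), pow_smul_quotient le_rfl]
  simp [one_val]

end CharZero

/-- The coefficient `η_s` of `ħ ^ s` in the expansion of the series. -/
def trivPseudopoly (s : ℕ) : ℕ × ℕ →₀ k :=
  ∑ r ∈ Finset.range (s + 1), Finsupp.single (r, r + 1) (coeff s (trivCoeff k r))

variable {k} in
theorem pseudopolyWq_eq (c : ℕ × ℕ →₀ k) :
    pseudopolyWq c = QWeyl.ofCoeffs (1 + ħ) (c.mapRange C (map_zero _)) := by
  rw [pseudopolyWq, QWeyl.ofCoeffs, Finsupp.linearCombination_apply,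
    Finsupp.sum_mapRange_index (by simp)]

theorem pseudopolyWq_trivPseudopoly (s : ℕ) : pseudopolyWq (trivPseudopoly k s)
    = ∑ r ∈ Finset.range (s + 1), (C (coeff s (trivCoeff k r)) : PowerSeries k) •
        (xx ^ r * yy ^ (r + 1)) := by
  have h : (trivPseudopoly k s).mapRange (C : k →+* PowerSeries k) (map_zero _)
      = ∑ r ∈ Finset.range (s + 1), Finsupp.single (r, r + 1) (C (coeff s (trivCoeff k r))) := by
    refine (map_sum (Finsupp.mapRange.addMonoidHom (C : k →+* PowerSeries k).toAddMonoidHom)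
      _ _).trans ?_
    exact Finset.sum_congr rfl fun r _ => Finsupp.mapRange_single (hf := map_zero C)
  rw [pseudopolyWq_eq, h, map_sum]
  exact Finset.sum_congr rfl fun r _ => QWeyl.ofCoeffs_single _ _

theorem coeff_trivCoeff {r s : ℕ} (h : s < r) : coeff s (trivCoeff k r) = 0 := by
  rw [trivCoeff, coeff_X_pow_mul', if_neg (by omega)]

/-- The series for `z` may be rearranged by powers of `ħ`, since `a_r` is divisible by `ħ ^ r`. -/
theorem mk_sum_trivPseudopoly (n : ℕ) :
    Ideal.Quotient.mk (adicIdeal ħ (Wq k) n) (∑ r ∈ Finset.range n, trivTerm k r)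
      = Ideal.Quotient.mk _
          (∑ s ∈ Finset.range n, ħ ^ s • pseudopolyWq (trivPseudopoly k s)) := by
  have hl : ∀ r, Ideal.Quotient.mk (adicIdeal ħ (Wq k) n) (trivTerm k r)
      = Ideal.Quotient.mk _ (∑ s ∈ Finset.range n,
          (ħ ^ s * C (coeff s (trivCoeff k r))) • (xx ^ r * yy ^ (r + 1))) := fun r => by
    obtain ⟨d, hd⟩ := exists_sub_sum_eq (trivCoeff k r) n
    rw [sub_eq_iff_eq_add] at hd
    rw [trivTerm, ← Finset.sum_smul]
    conv_lhs => rw [hd]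
    rw [add_smul, map_add, mul_smul, mk_smul (X ^ n), pow_smul_quotient le_rfl, zero_add]
  rw [map_sum]
  simp only [hl]
  rw [← map_sum, Finset.sum_comm]
  congr 1
  refine Finset.sum_congr rfl fun s hs => ?_
  rw [pseudopolyWq_trivPseudopoly, Finset.smul_sum]
  have hsn : s + 1 ≤ n := Finset.mem_range.1 hs
  rw [← Finset.sum_subset (Finset.range_mono hsn)]
  · exact Finset.sum_congr rfl fun r _ => mul_smul ..
  · intro r _ hr
    rw [coeff_trivCoeff k (by simpa using hr), map_zero, mul_zero, zero_smul]

end Trivialization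

section Trivialization

open PowerSeries AdicAlgebra

variable (k : Type u) [Field k]

local notation "ħ" => hbar k
local notation "xx" => xq k
local notation "yy" => yq k

section Reduction

variable {k} {φ : W1 k →+* WqHat k} {z : WqHat k} (hx : φ (QWeyl.x k 1) = of (hbar k) (xq k))
  (hy : φ (QWeyl.y k 1) = z)
  (hφ : ∀ c, φ (algebraMap k (W1 k) c) = algebraMap (PowerSeries k) (WqHat k) (C c))
  (hz : z.1 1 = Ideal.Quotient.mk _ (yq k))

include hx hy hφ hz

/-- Modulo `ħ` the homomorphism `φ` sends `x ^ i y ^ j` to `x ^ i y ^ j`, since `z` reduces to `y`: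
it is the identification of `W₁` with the specialization of `W_q` at `ħ = 0`. -/
theorem hom_ofCoeffs_val_one (c : ℕ × ℕ →₀ k) : (φ (QWeyl.ofCoeffs 1 c)).1 1
    = Ideal.Quotient.mk _ (QWeyl.ofCoeffs (1 + ħ) (c.mapRange C (map_zero _))) := by
  induction c using Finsupp.induction_linear with
  | zero => simp [zero_val]
  | add c d hc hd => rw [map_add, map_add, add_val, hc, hd, Finsupp.mapRange_add (map_add C),
      map_add, map_add]
  | single p r =>
    have hpow : ∀ (w : WqHat k) (i : ℕ), (w ^ i).1 1 = w.1 1 ^ i := fun w i => rfl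
    rw [Finsupp.mapRange_single, QWeyl.ofCoeffs_single, QWeyl.ofCoeffs_single, Algebra.smul_def,
      map_mul, hφ, ← Algebra.smul_def, smul_val, mk_smul, map_mul, map_pow, map_pow, mul_val, hpow,
      hpow, hx, hy, hz, of_val, map_mul, map_pow, map_pow]

theorem hom_val_one_eq_zero (b : W1 k) (hb : (φ b).1 1 = 0) : b = 0 := by
  rw [← QWeyl.ofCoeffs_repr b, hom_ofCoeffs_val_one hx hy hφ hz] at hb
  obtain ⟨a, ha⟩ := mk_eq_zero.1 hb
  apply (QWeyl.basis 1).repr.injective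
  ext p
  have h := QWeyl.X_pow_dvd_repr ha p
  rw [QWeyl.repr_ofCoeffs, Finsupp.mapRange_apply, pow_one, X_dvd_iff, constantCoeff_C] at h
  rw [h, map_zero, Finsupp.zero_apply]

theorem exists_hom_val_one (w : WqHat k) : ∃ b, (φ b).1 1 = w.1 1 := by
  obtain ⟨a, ha⟩ := Ideal.Quotient.mk_surjective (w.1 1)
  set d := (QWeyl.basis (1 + ħ)).repr a with hd
  refine ⟨QWeyl.ofCoeffs 1 (d.mapRange (constantCoeff (R := k)) (map_zero _)), ?_⟩
  -- A power series is its constant term plus `ħ` times its shift.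
  have h : d = (X : PowerSeries k) • d.mapRange
        (fun f : PowerSeries k => PowerSeries.mk fun n => coeff (n + 1) f) (by ext; simp)
      + (d.mapRange (constantCoeff (R := k)) (map_zero _)).mapRange
        (C : k →+* PowerSeries k) (map_zero _) := by
    ext p : 1
    simpa using eq_X_mul_shift_add_const (d p)
  rw [hom_ofCoeffs_val_one hx hy hφ hz, ← ha, ← QWeyl.ofCoeffs_repr a, ← hd]
  conv_rhs => rw [h, map_add, map_add, map_smul, mk_smul, ← pow_one X, pow_smul_quotient le_rfl,
    zero_add]

end Reduction

variable [CharZero k]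

/-- The trivialization of the completed deformation: the homomorphism `x ↦ x`, `y ↦ z` is bijective
because it is so modulo `ħ`. -/
theorem exists_trivialization : ∃ (z : WqHat k) (Φ : PowerSeries (W1 k) ≃ₐ[PowerSeries k] WqHat k),
    (∀ n, z.1 n = Ideal.Quotient.mk _ (∑ r ∈ Finset.range n, trivTerm k r)) ∧
    Φ (C (QWeyl.x k 1)) = of ħ xx ∧ Φ (C (QWeyl.y k 1)) = z := by
  obtain ⟨z, hz⟩ := exists_sum (trivTerm_dvd k)
  obtain ⟨φ, hx, hy, hφ⟩ := exists_hom_of_relation (k := k) (commutator_of_val_eq k hz)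
  have hz1 : z.1 1 = Ideal.Quotient.mk _ yy := by
    rw [hz, Finset.sum_range_one, trivTerm_zero]
  let Φ : PowerSeries (W1 k) →ₐ[PowerSeries k] WqHat k :=
    { evalSeries φ with commutes' := evalSeries_map φ hφ }
  refine ⟨z, AlgEquiv.ofBijective Φ
    ⟨evalSeries_injective φ QWeyl.eq_zero_of_X_smul (hom_val_one_eq_zero hx hy hφ hz1),
      evalSeries_surjective φ QWeyl.eq_zero_of_X_smul (exists_hom_val_one hx hy hφ hz1)⟩,
    hz, (evalSeries_C φ _).trans hx, (evalSeries_C φ _).trans hy⟩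

/-! ### Cohomology of the deformation -/

theorem W1.hochschild_subsingleton (n : ℕ) : Subsingleton (HochschildCohomology k (W1 k) (n + 1)) :=
  hochschildCohomology_subsingleton_iff.2 W1.exists_primitive

theorem WqHat.hochschild_subsingleton (n : ℕ) :
    Subsingleton (HochschildCohomology (PowerSeries k) (WqHat k) (n + 1)) := by
  obtain ⟨_, Φ, _⟩ := exists_trivialization k
  exact hochschildCohomology_subsingleton_iff.2 <| Φ.hochschild_exists_primitive <|
    QWeyl.exists_primitive_powerSeries W1.exists_primitive

/-- Classes of positive degree are fragile because the cohomology of the completion vanishes. -/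
theorem fragileClasses_eq_top (n : ℕ) : fragileClasses ħ (Wq k) (n + 1) = ⊤ := by
  have := WqHat.hochschild_subsingleton k n
  exact Submodule.eq_top_iff'.2 fun c => ⟨0, Subsingleton.elim _ _⟩

/-- The center of `W_q` consists of the constants: central elements of `W_q` are central in the
completion, and correspond to series with coefficients in the center of `W₁`. -/
theorem Wq.exists_eq_algebraMap (a : Wq k) (ha : ∀ b, b * a = a * b) :
    ∃ r, a = algebraMap (PowerSeries k) (Wq k) r := by
  obtain ⟨z, Φ, -, hx, hy⟩ := exists_trivialization k
  have hcomm : ∀ w : WqHat k, w * of ħ a = of ħ a * w := fun w => ext_val fun n => by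
    obtain ⟨b, hb⟩ := Ideal.Quotient.mk_surjective (w.1 n)
    rw [mul_val, mul_val, ← hb, of_val, ← map_mul, ← map_mul, ha]
  set f := Φ.symm (of ħ a) with hf
  have hcomm' : ∀ g, g * f = f * g := fun g => by
    apply Φ.injective
    rw [map_mul, map_mul, hf, AlgEquiv.apply_symm_apply, hcomm]
  have hcoeff : ∀ n, ∃ r : k, coeff n f = algebraMap k (W1 k) r := fun n =>
    QWeyl.eq_algebraMap_of_commute
      (by simpa using congrArg (coeff n) (hcomm' (C (QWeyl.x k 1))))
      (by simpa using congrArg (coeff n) (hcomm' (C (QWeyl.y k 1))))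
  choose r hr using hcoeff
  have hfr : f = algebraMap (PowerSeries k) (PowerSeries (W1 k)) (PowerSeries.mk r) := by
    ext n
    refine (hr n).trans ?_
    change _ = coeff n (map (algebraMap k (W1 k)) (PowerSeries.mk r))
    rw [coeff_map, coeff_mk]
  refine ⟨PowerSeries.mk r, QWeyl.of_injective ?_⟩
  rw [AlgHom.commutes, ← Φ.commutes, ← hfr, hf, AlgEquiv.apply_symm_apply]

/-- In degree zero no nonzero constant is fragile, as `W_q` is torsion-free and embeds in its
completion, and every class is a constant, as these form the center. -/
theorem bijective_resilient_const : Function.Bijective ((fragileClasses ħ (Wq k) 0).mkQ ∘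
    HochschildCohomology.const (PowerSeries k) (Wq k)) := by
  constructor
  · rw [← LinearMap.coe_comp, injective_iff_map_eq_zero]
    intro r hr
    obtain ⟨m, hm⟩ := (Submodule.Quotient.mk_eq_zero _).1 hr
    have h1 : ħ ^ m • of ħ (algebraMap (PowerSeries k) (Wq k) r) = 0 :=
      DFunLike.congr_fun (F := HochschildCochain (PowerSeries k) (WqHat k) 0) (g := 0)
        ((Submodule.Quotient.mk_eq_zero _).1 hm) ![]
    rw [← map_smul] at h1
    have h2 := QWeyl.of_injective (h1.trans (map_zero _).symm)
    rw [Algebra.smul_def, ← map_mul] at h2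
    have h3 := QWeyl.algebraMap_injective (h2.trans (map_zero _).symm)
    exact (mul_eq_zero.1 h3).resolve_left (pow_ne_zero _ X_ne_zero)
  · intro c
    obtain ⟨c, rfl⟩ := Submodule.mkQ_surjective _ c
    obtain ⟨⟨f, hf⟩, rfl⟩ := Submodule.mkQ_surjective _ c
    obtain ⟨r, hr⟩ := Wq.exists_eq_algebraMap k (f ![]) fun b => by
      have h := hf ![b]
      simp only [hochschildD] at h
      have e : ∀ a : Fin 0 → Wq k, f a = f ![] := fun a => congrArg f (Subsingleton.elim _ _)
      rw [e fun i => ![b] i.succ, e fun i => ![b] i.castSucc] at h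
      simpa [sub_eq_zero, ← sub_eq_add_neg] using h
    refine ⟨r, congrArg _ (congrArg _ (Subtype.ext (DFunLike.ext _ _ fun a => ?_)))⟩
    rw [Subsingleton.elim a ![]]
    exact hr.symm

end Trivialization

end

theorem theorem4 (k : Type u) [Field k] [CharZero k] :
    -- for `q = 1 + ħ` the `k[[ħ]]`-algebras `W₁[[ħ]]` and `W_q[[ħ]]` are identified through
    -- `x ↦ x`, `y ↦ z`
    (∃ (a : ℕ → PowerSeries k) (z : WqHat k)
        (Φ : PowerSeries (W1 k) ≃ₐ[PowerSeries k] WqHat k),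
      (∀ r : ℕ, a r * ((1 + hbar k) ^ (r + 1) - 1) = hbar k ^ (r + 1)) ∧
      a 0 = 1 ∧
      AdicAlgebra.HasSum (fun r => a r • (xq k ^ r * yq k ^ (r + 1))) z ∧
      (∃ η : ℕ → (ℕ × ℕ →₀ k), pseudopolyWq (η 0) = yq k ∧
        AdicAlgebra.HasSum (fun r => hbar k ^ r • pseudopolyWq (η r)) z) ∧
      AdicAlgebra.of (hbar k) (xq k) * z - z * AdicAlgebra.of (hbar k) (xq k) = 1 ∧
      Φ (PowerSeries.C (QWeyl.x k 1)) = AdicAlgebra.of (hbar k) (xq k) ∧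
      Φ (PowerSeries.C (QWeyl.y k 1)) = z) ∧
    -- the cohomology of `W₁` over `k` and that of `W_q[[ħ]]` over `k[[ħ]]` vanish in positive
    -- degrees
    (∀ n : ℕ, 0 < n → Subsingleton (HochschildCohomology k (W1 k) n)) ∧
    (∀ n : ℕ, 0 < n → Subsingleton (HochschildCohomology (PowerSeries k) (WqHat k) n)) ∧
    -- all classes of `W_q` of positive degree are fragile at `q = 1`, and the resilient
    -- cohomology of `W_q` consists of the constants in degree `0` only
    (∀ n : ℕ, 0 < n → fragileClasses (hbar k) (Wq k) n = ⊤) ∧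
    (∀ n : ℕ, 0 < n → Subsingleton (ResilientCohomology (hbar k) (Wq k) n)) ∧
    Function.Bijective ((fragileClasses (hbar k) (Wq k) 0).mkQ ∘
      HochschildCohomology.const (PowerSeries k) (Wq k)) := by
  refine ⟨?_, ?_, ?_, ?_, ?_, bijective_resilient_const k⟩
  · obtain ⟨z, Φ, hz, hx, hy⟩ := exists_trivialization k
    refine ⟨trivCoeff k, z, Φ, trivCoeff_mul k, trivCoeff_zero k,
      AdicAlgebra.hasSum_of_val_eq (trivTerm_dvd k) hz, ⟨trivPseudopoly k, ?_,
        AdicAlgebra.hasSum_of_val_eq (fun r => ⟨_, rfl⟩) fun n => ?_⟩,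
      commutator_of_val_eq k hz, hx, hy⟩
    · simp [pseudopolyWq_trivPseudopoly, trivCoeff_zero]
    · rw [hz, mk_sum_trivPseudopoly]
  · rintro (_ | n) hn
    · exact absurd hn (lt_irrefl 0)
    · exact W1.hochschild_subsingleton k n
  · rintro (_ | n) hn
    · exact absurd hn (lt_irrefl 0)
    · exact WqHat.hochschild_subsingleton k n
  · rintro (_ | n) hn
    · exact absurd hn (lt_irrefl 0)
    · exact fragileClasses_eq_top k n
  · rintro (_ | n) hn
    · exact absurd hn (lt_irrefl 0)
    · rw [ResilientCohomology, fragileClasses_eq_top]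
      infer_instance
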